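/- **Setting.** Let $1\le p<\infty$, $r:=\max\{p,2\}$, $n\ge 1$, let $X=B_p(0,1)\subset\mathbb R^n$ be the closed unit ball of the $L^p$ norm, and let $\mathcal F$ be the family of all convex functions $f\colon X\to\mathbb R$ that are Lipschitz with constant $1$ in the $L^p$ norm. An *$\varepsilon$-minimum* of $f$ is a point $x\in X$ with $f(x)<\min_X f+\varepsilon$. An *oracle* $\mathcal O$ for $\mathcal F$ answers a query $x\in X$ on the instance $f\in\mathcal F$ with an element $\mathcal O_f(x)$ of some set; it is *local* if $\mathcal O_f(x)=\mathcal O_g(x)$ whenever $f=g$ in a neighbourhood of $x$ in $X$. A deterministic algorithm $A$ chooses, on the basis of the previous queries and answers, its next query, its current output and whether it halts. $T_A(f,\varepsilon)$ is the least number of queries after which the output of $A$ is an $\varepsilon$-minimum of $f$ ($\infty$ if there is none). Put $$\mathrm{Compl}_{\mathcal D}(\mathcal O,\varepsilon)=\sup_F\inf_A\mathbb E_F[T_A(F,\varepsilon)],\qquad \mathrm{Compl}^{\eta}_{\mathcal{HP}}(\mathcal O,\varepsilon)=\sup_F\inf_A\sup\{\tau:\mathbb P_F[T_A(F,\varepsilon)\ge\tau]\ge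 1-\eta\},$$ where $F$ ranges over the probability distributions on $\mathcal F$ and $A$ over the deterministic algorithms. For $0\le P_e<1$ define $\mathrm{Compl}_{\mathcal D}(\mathcal O,\varepsilon;P_e)$ and $\mathrm{Compl}^{\eta}_{\mathcal{HP}}(\mathcal O,\varepsilon;P_e)$ in the same way, with $A$ ranging over the (possibly randomized) algorithms that, with probability at least $1-P_e$ over the instance $F$ and their private randomness, halt and return an $\varepsilon$-minimum, with $T$ the number of queries asked until $A$ halts, and with $1-P_e-\eta$ in place of $1-\eta$. **Theorem.** There are absolute constants $c,C>0$ and a function $\eta$ with $\eta(\varepsilon)\to0$ as $\varepsilon\to0^+$ such that, for all $1\le p<\infty$, $n\ge1$ and $\varepsilon$ with $1/n^{1/\max\{p,2\}}\le\varepsilon\le1$, and for every local oracle $\mathcal O$ for $\mathcal F$, $$\mathrm{Compl}_{\mathcal D}(\mathcal O,\varepsilon)\ \ge\ \frac{c}{\varepsilon^{\max\{p,2\}}},\qquad \mathrm{Compl}^{\eta(\varepsilon)}_{\mathcal{HP}}(\mathcal O,\varepsilon)\ \ge\ \frac{c}{\varepsilon^{\max\{p,2\}}},$$ and, for every $0\le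 P_e<1$, $$\mathrm{Compl}_{\mathcal D}(\mathcal O,\varepsilon;P_e)\ \ge\ \frac{c\,(1-P_e)}{\varepsilon^{\max\{p,2\}}}\quad\text{whenever } \frac{1-P_e}{\varepsilon^{\max\{p,2\}}}\ge C,\qquad \mathrm{Compl}^{\eta(\varepsilon)}_{\mathcal{HP}}(\mathcal O,\varepsilon;P_e)\ \ge\ \frac{c}{\varepsilon^{\max\{p,2\}}}.$$ -/

import Mathlib

open MeasureTheory Filter Topology
open scoped ENNReal

noncomputable section

/-- The closed unit ball `B_p(0,1)` of `ℝⁿ` in the `L^p` norm. -/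
abbrev LpBall (p : ℝ≥0∞) [Fact (1 ≤ p)] (n : ℕ) : Set (PiLp p fun _ : Fin n => ℝ) :=
  Metric.closedBall 0 1

/-- The family of all real functions on the unit `L^p`-ball of `ℝⁿ` that are convex and Lipschitz
continuous with constant `1` in the `L^p` norm. -/
def lipConvexFamily (p : ℝ≥0∞) [Fact (1 ≤ p)] (n : ℕ) : Set (LpBall p n → ℝ) :=
  {f | LipschitzWith 1 f ∧
    ∃ g : (PiLp p fun _ : Fin n => ℝ) → ℝ, ConvexOn ℝ (LpBall p n) g ∧ ∀ x : LpBall p n, f x = g x}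

/-- `x` is an `ε`-minimum of `f`: `f x < min f + ε`. -/
def IsEpsMin {X : Type*} (f : X → ℝ) (ε : ℝ) (x : X) : Prop :=
  ∃ z, (∀ y, f z ≤ f y) ∧ f x < f z + ε

/-- An oracle for the family `𝓕`, with answers in `R`, that is local: instances that agree in some
neighbourhood of the query point receive the same answer. -/
structure LocalOracle {X : Type*} [TopologicalSpace X] (𝓕 : Set (X → ℝ)) (R : Type*) where
  answer : 𝓕 → X → R
  isLocal : ∀ (f g : 𝓕) (x : X), (∀ᶠ y in 𝓝 x, f.1 y = g.1 y) → answer f x = answer g x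

/-- A deterministic oracle-based algorithm. From the list of the query-answer pairs seen so far it
determines the next query, whether it halts now instead of asking it, and its current output. -/
structure OracleAlg (X R : Type*) where
  query : List (X × R) → X
  halt : List (X × R) → Prop
  output : List (X × R) → X

namespace OracleAlg

variable {X R : Type*}

/-- The query-answer pairs of the first `t` queries, `a` being the oracle's answers on the
instance at hand. -/
def transcript (A : OracleAlg X R) (a : X → R) : ℕ → List (X × R)
  | 0 => []
  | t + 1 => A.transcript a t ++
      [(A.query (A.transcript a t), a (A.query (A.transcript a t)))]

/-- `T_A(f, ε)`: the least number of queries after which the output of `A` is an `ε`-minimum of `f`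
(`∞` if this never happens). The algorithm need not know that it has found one. -/
def findTime (A : OracleAlg X R) (a : X → R) (f : X → ℝ) (ε : ℝ) : ℝ≥0∞ :=
  ⨅ (t : ℕ) (_ : IsEpsMin f ε (A.output (A.transcript a t))), (t : ℝ≥0∞)

/-- The number of queries that `A` asks until it halts (`∞` if it never halts). -/
def queryCount (A : OracleAlg X R) (a : X → R) : ℝ≥0∞ :=
  ⨅ (t : ℕ) (_ : A.halt (A.transcript a t)), (t : ℝ≥0∞)

/-- `A` halts, and what it returns then is an `ε`-minimum of `f`. -/
def Succeeds (A : OracleAlg X R) (a : X → R) (f : X → ℝ) (ε : ℝ) : Prop :=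
  ∃ t : ℕ, A.halt (A.transcript a t) ∧ (∀ s < t, ¬ A.halt (A.transcript a s)) ∧
    IsEpsMin f ε (A.output (A.transcript a t))

end OracleAlg

/-- An algorithm with private randomness: a deterministic algorithm chosen by a random seed.
On each instance, the number of queries and the success are random variables. -/
structure RandOracleAlg {X : Type*} [TopologicalSpace X] {𝓕 : Set (X → ℝ)} {R : Type*}
    (O : LocalOracle 𝓕 R) (ε : ℝ) where
  Seed : Type
  [measurableSpace : MeasurableSpace Seed]
  law : Measure Seed
  [isProbabilityMeasure : IsProbabilityMeasure law]
  alg : Seed → OracleAlg X R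
  measurable_queryCount : ∀ f : 𝓕, Measurable fun ω => (alg ω).queryCount (O.answer f)
  measurableSet_succeeds : ∀ f : 𝓕, MeasurableSet {ω | (alg ω).Succeeds (O.answer f) f.1 ε}

section Complexity

/- Distributions on `𝓕` are taken with respect to the σ-algebra generated by the evaluations
`f ↦ f x`; for continuous functions on a compact metric space it is the Borel σ-algebra of uniform
convergence. Neither oracle nor algorithm has to depend measurably on the instance: the lower
integral `∫⁻`, and the outer measure of `{T < τ}`, are the readings of `𝔼[T]` and of
`1 - ℙ(T ≥ τ)` under which a lower bound says most. -/

variable {X : Type*} [TopologicalSpace X] {𝓕 : Set (X → ℝ)} {R : Type*}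

/-- Distributional oracle complexity `sup_F inf_A 𝔼_F[T_A(F, ε)]`. -/
def distComplexity (O : LocalOracle 𝓕 R) (ε : ℝ) : ℝ≥0∞ :=
  ⨆ μ : ProbabilityMeasure 𝓕, ⨅ A : OracleAlg X R,
    ∫⁻ f, A.findTime (O.answer f) f.1 ε ∂(μ : Measure 𝓕)

/-- High-probability oracle complexity `sup_F inf_A sup {τ | ℙ_F(T_A(F, ε) ≥ τ) ≥ 1 - η}`,
where `η` stands for the value of the `o(1)` term. -/
def hpComplexity (O : LocalOracle 𝓕 R) (ε η : ℝ) : ℝ≥0∞ :=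
  ⨆ μ : ProbabilityMeasure 𝓕, ⨅ A : OracleAlg X R,
    sSup {τ : ℝ≥0∞ |
      (μ : Measure 𝓕) {f | A.findTime (O.answer f) f.1 ε < τ} ≤ ENNReal.ofReal η}

attribute [instance] RandOracleAlg.measurableSpace RandOracleAlg.isProbabilityMeasure

namespace RandOracleAlg

variable {O : LocalOracle 𝓕 R} {ε : ℝ}

/-- The probability, over the instance and the seed, of not returning an `ε`-minimum. -/
def errorProb (B : RandOracleAlg O ε) (μ : ProbabilityMeasure 𝓕) : ℝ≥0∞ :=
  ∫⁻ f, B.law {ω | ¬ (B.alg ω).Succeeds (O.answer f) f.1 ε} ∂(μ : Measure 𝓕)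

/-- The expected number of queries over the instance and the seed. -/
def expectedQueries (B : RandOracleAlg O ε) (μ : ProbabilityMeasure 𝓕) : ℝ≥0∞ :=
  ∫⁻ f, (∫⁻ ω, (B.alg ω).queryCount (O.answer f) ∂B.law) ∂(μ : Measure 𝓕)

/-- The probability, over the instance and the seed, that at least `τ` queries are asked. -/
def probQueriesGe (B : RandOracleAlg O ε) (μ : ProbabilityMeasure 𝓕) (τ : ℝ≥0∞) : ℝ≥0∞ :=
  ∫⁻ f, B.law {ω | τ ≤ (B.alg ω).queryCount (O.answer f)} ∂(μ : Measure 𝓕)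

end RandOracleAlg

/-- Distributional complexity for algorithms with error probability at most `Pe`. -/
def distComplexityErr (O : LocalOracle 𝓕 R) (ε Pe : ℝ) : ℝ≥0∞ :=
  ⨆ μ : ProbabilityMeasure 𝓕, ⨅ (B : RandOracleAlg O ε)
    (_ : B.errorProb μ ≤ ENNReal.ofReal Pe), B.expectedQueries μ

/-- High-probability complexity for algorithms with error probability at most `Pe`: the number of
queries is at least `τ` with probability at least `1 - Pe - η`, where `η` stands for the value of
the `o(1)` term. -/
def hpComplexityErr (O : LocalOracle 𝓕 R) (ε Pe η : ℝ) : ℝ≥0∞ :=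
  ⨆ μ : ProbabilityMeasure 𝓕, ⨅ (B : RandOracleAlg O ε)
    (_ : B.errorProb μ ≤ ENNReal.ofReal Pe),
    sSup {τ : ℝ≥0∞ | ENNReal.ofReal (1 - Pe - η) ≤ B.probQueriesGe μ τ}

end Complexity

end

/-! The hard instance is a maximum of `M = 2 ^ k` linear functionals of dual norm at most one, with
`M` between `ε^(-r)/4` and `ε^(-r)/2`, `r = max p 2`. Each functional carries a random sign and is
raised by a random one of `K` levels in `[0, δ]`. Whatever the signs, some point of the ball brings
the maximum so low that every `ε`-minimum makes all signed functionals negative, hence determines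
all `M` signs (`exists_functionals_of_signs`, `fst_eq_of_isEpsMin`). Near a query the instance
depends only on the components attaining the maximum there, and for large `K` ties are rare. So a
query mostly pins down one component, and of the others it reveals only that they lie below the
maximum.

This becomes a count over boxes `∏ S j` of parameters on which the transcript is constant. On a box
an output can be right for at most as many parameters as the product of the majority counts of
signs. A query cuts the box by the value of the maximum and by the components attaining it. The
potential that controls the cutting is the product of `signWeight` over the components not yet
known. The majority alone would not do, as it need not drop when elements of the minority sign are
cut off; the cardinality alone would do, but gives no gain over the trivial bound. Their geometric
mean dominates the majority, its decrements control the number of elements removed, and it starts at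
about `√2 * K` against `2 * K` parameters per component.

Hence a query multiplies the total weight by at most `5` (`card_filter_box_le_of_split`), and with
the outputs before the query counted, `t` queries solve at most `6 ^ t` times the initial weight
(`OracleAlg.card_filter_success_le`). For `12 * t ≤ M` this is a fraction `2 * 2^(-M/4)` of all
parameters (`exists_levels_card_success_le`). Averaging over the uniform law, and over the seed for
randomized algorithms, turns it into all four bounds. When `ε^(-r) ≤ 32`, a pair of linear instances
handles the one bound that is not immediate. -/

noncomputable section

/-! ### Elementary inequalities for products and a telescoping sum -/

section ProductInequalities

variable {ι : Type*} [DecidableEq ι]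

/-- The left side is the part of the expansion of `∏ (g j + e j)` that is linear in `e`; all other
terms are nonnegative. -/
theorem sum_mul_prod_erase_le (U : Finset ι) (g e : ι → ℝ) (hg : ∀ j ∈ U, 0 ≤ g j)
    (he : ∀ j ∈ U, 0 ≤ e j) :
    ∑ i ∈ U, e i * ∏ j ∈ U.erase i, g j ≤ ∏ j ∈ U, (g j + e j) - ∏ j ∈ U, g j := by
  induction U using Finset.induction_on with
  | empty => simp
  | insert a s ha ih =>
    have hg' : ∀ j ∈ s, 0 ≤ g j := fun j hj => hg j (Finset.mem_insert_of_mem hj)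
    have he' : ∀ j ∈ s, 0 ≤ e j := fun j hj => he j (Finset.mem_insert_of_mem hj)
    have ih := ih hg' he'
    have hga := hg a (Finset.mem_insert_self _ _)
    have hea := he a (Finset.mem_insert_self _ _)
    rw [Finset.sum_insert ha, Finset.prod_insert ha, Finset.prod_insert ha,
      Finset.erase_insert ha]
    have h1 : ∑ i ∈ s, e i * ∏ j ∈ (insert a s).erase i, g j
        = g a * ∑ i ∈ s, e i * ∏ j ∈ s.erase i, g j := by
      rw [Finset.mul_sum]
      refine Finset.sum_congr rfl fun i hi => ?_
      have hia : a ≠ i := fun h => ha (h ▸ hi)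
      rw [Finset.erase_insert_of_ne hia, Finset.prod_insert (by simp [ha])]
      ring
    rw [h1]
    have h2 : ∏ j ∈ s, g j ≤ ∏ j ∈ s, (g j + e j) :=
      Finset.prod_le_prod hg' fun j hj => by linarith [he' j hj]
    nlinarith [mul_le_mul_of_nonneg_left ih hga, mul_le_mul_of_nonneg_left h2 hea]

/-- Changing one factor at a time costs `e i` times a product of the other factors, each at most its
larger value. -/
theorem prod_add_sub_prod_le (U : Finset ι) (g e : ι → ℝ) (hg : ∀ j ∈ U, 0 ≤ g j)
    (he : ∀ j ∈ U, 0 ≤ e j) :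
    ∏ j ∈ U, (e j + g j) - ∏ j ∈ U, g j ≤ ∑ i ∈ U, e i * ∏ j ∈ U.erase i, (e j + g j) := by
  induction U using Finset.induction_on with
  | empty => simp
  | insert a s ha ih =>
    have hg' : ∀ j ∈ s, 0 ≤ g j := fun j hj => hg j (Finset.mem_insert_of_mem hj)
    have he' : ∀ j ∈ s, 0 ≤ e j := fun j hj => he j (Finset.mem_insert_of_mem hj)
    have ih := ih hg' he'
    have hga := hg a (Finset.mem_insert_self _ _)
    have hea := he a (Finset.mem_insert_self _ _)
    rw [Finset.sum_insert ha, Finset.prod_insert ha, Finset.prod_insert ha,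
      Finset.erase_insert ha]
    have h1 : ∑ i ∈ s, e i * ∏ j ∈ (insert a s).erase i, (e j + g j)
        = (e a + g a) * ∑ i ∈ s, e i * ∏ j ∈ s.erase i, (e j + g j) := by
      rw [Finset.mul_sum]
      refine Finset.sum_congr rfl fun i hi => ?_
      have hia : a ≠ i := fun h => ha (h ▸ hi)
      rw [Finset.erase_insert_of_ne hia, Finset.prod_insert (by simp [ha])]
      ring
    rw [h1]
    have h3 : 0 ≤ ∑ i ∈ s, e i * ∏ j ∈ s.erase i, (e j + g j) :=
      Finset.sum_nonneg fun i hi => mul_nonneg (he' i hi) <| Finset.prod_nonneg fun j hj => by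
        have := Finset.mem_of_mem_erase hj
        linarith [he' j this, hg' j this]
    nlinarith [mul_le_mul_of_nonneg_left ih hga, mul_nonneg hea h3]

/-- In the expansion, each term with at least one `θ` is bounded by replacing every remaining `v j`
by `W j`; the binomial sum of these terms is the factor on the right. -/
theorem prod_add_smul_le (U : Finset ι) (v W : ι → ℝ) {θ : ℝ} (hθ : 0 ≤ θ)
    (hv : ∀ j ∈ U, 0 ≤ v j) (hvW : ∀ j ∈ U, v j ≤ W j) :
    ∏ j ∈ U, (v j + θ * W j) ≤ ∏ j ∈ U, v j + ((1 + θ) ^ U.card - 1) * ∏ j ∈ U, W j := by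
  induction U using Finset.induction_on with
  | empty => simp
  | insert a s ha ih =>
    have hv' : ∀ j ∈ s, 0 ≤ v j := fun j hj => hv j (Finset.mem_insert_of_mem hj)
    have hW' : ∀ j ∈ s, v j ≤ W j := fun j hj => hvW j (Finset.mem_insert_of_mem hj)
    have ih := ih hv' hW'
    have hva := hv a (Finset.mem_insert_self _ _)
    have hWa := hvW a (Finset.mem_insert_self _ _)
    rw [Finset.prod_insert ha, Finset.prod_insert ha, Finset.prod_insert ha,
      Finset.card_insert_of_notMem ha, pow_succ]
    have h1 : ∏ j ∈ s, v j ≤ ∏ j ∈ s, W j := Finset.prod_le_prod hv' hW'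
    have h0 : 0 ≤ ∏ j ∈ s, v j := Finset.prod_nonneg hv'
    have he : 0 ≤ (1 + θ) ^ s.card - 1 := by
      linarith [one_le_pow₀ (n := s.card) (by linarith : (1 : ℝ) ≤ 1 + θ)]
    obtain ⟨e, hpow⟩ : ∃ e, (1 + θ) ^ s.card = e + 1 := ⟨_, (sub_add_cancel _ 1).symm⟩
    rw [hpow, add_sub_cancel_right] at ih he
    rw [hpow]
    generalize ∏ j ∈ s, v j = P at *
    generalize ∏ j ∈ s, W j = Q at *
    have h2 : (v a + θ * W a) * ∏ j ∈ s, (v j + θ * W j) ≤ (v a + θ * W a) * (P + e * Q) :=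
      mul_le_mul_of_nonneg_left ih (by have := mul_nonneg hθ (hva.trans hWa); linarith)
    have h3 : v a * (e * Q) ≤ W a * (e * Q) :=
      mul_le_mul_of_nonneg_right hWa (mul_nonneg he (h0.trans h1))
    have h4 : θ * W a * P ≤ θ * W a * Q :=
      mul_le_mul_of_nonneg_left h1 (mul_nonneg hθ (hva.trans hWa))
    nlinarith

/-- The intervals `[G y, F y]` lie in order without overlap inside `[0, C]`. In the induction, the
lower end at the largest point bounds all earlier upper ends. -/
theorem sum_sub_le_of_interlaced (Y : Finset ℝ) (F G : ℝ → ℝ) (hG : ∀ y, 0 ≤ G y)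
    (h : ∀ y y', y < y' → F y ≤ G y') (C : ℝ) (hC : 0 ≤ C) (hF : ∀ y ∈ Y, F y ≤ C) :
    ∑ y ∈ Y, (F y - G y) ≤ C := by
  induction Y using Finset.induction_on_max generalizing C with
  | empty => simpa using hC
  | insert a s ha ih =>
    rw [Finset.sum_insert fun h => lt_irrefl _ (ha a h)]
    have := ih (G a) (hG a) fun y hy => h y a (ha y hy)
    linarith [hF a (Finset.mem_insert_self _ _)]

end ProductInequalities

/-! ### The weight of a set of signed levels -/

section Weight

variable {Θ : Type*}

/-- The number of elements of `S` that carry the more frequent sign. -/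
def majority (sgn : Θ → Bool) (S : Finset Θ) : ℕ :=
  max (S.filter (sgn · = true)).card (S.filter (sgn · = false)).card

/-- The geometric mean of `#S` and of the (smoothed) number of elements with the more frequent
sign. -/
def signWeight (κ : ℝ) (sgn : Θ → Bool) (S : Finset Θ) : ℝ :=
  √(S.card * (majority sgn S + κ))

variable {κ : ℝ} {sgn : Θ → Bool} {S T : Finset Θ}

theorem majority_mono (h : T ⊆ S) : majority sgn T ≤ majority sgn S :=
  max_le_max (Finset.card_le_card (Finset.filter_subset_filter _ h))
    (Finset.card_le_card (Finset.filter_subset_filter _ h))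

theorem card_filter_sgn_le (b : Bool) : (S.filter (sgn · = b)).card ≤ majority sgn S := by
  cases b
  · exact le_max_right _ _
  · exact le_max_left _ _

theorem majority_le_card : majority sgn S ≤ S.card :=
  max_le (Finset.card_filter_le _ _) (Finset.card_filter_le _ _)

theorem card_le_two_mul_majority : S.card ≤ 2 * majority sgn S := by
  have h : S.card = (S.filter (sgn · = true)).card + (S.filter (sgn · = false)).card := by
    rw [← Finset.card_filter_add_card_filter_not (s := S) (sgn · = true)]
    simp
  have h1 := card_filter_sgn_le (sgn := sgn) (S := S) true
  have h2 := card_filter_sgn_le (sgn := sgn) (S := S) false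
  omega

theorem signWeight_nonneg : 0 ≤ signWeight κ sgn S := Real.sqrt_nonneg _

theorem signWeight_mono (hκ : 0 ≤ κ) (h : T ⊆ S) : signWeight κ sgn T ≤ signWeight κ sgn S := by
  refine Real.sqrt_le_sqrt ?_
  have h1 : (T.card : ℝ) ≤ S.card := by exact_mod_cast Finset.card_le_card h
  have h2 : (majority sgn T : ℝ) ≤ majority sgn S := by exact_mod_cast majority_mono h
  gcongr

theorem majority_le_signWeight (hκ : 0 ≤ κ) : (majority sgn S : ℝ) ≤ signWeight κ sgn S := by
  refine Real.le_sqrt_of_sq_le ?_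
  have h1 : (majority sgn S : ℝ) ≤ S.card := by exact_mod_cast majority_le_card
  nlinarith [Nat.cast_nonneg (α := ℝ) (majority sgn S), Nat.cast_nonneg (α := ℝ) S.card]

theorem sqrt_le_signWeight (hκ : 0 ≤ κ) (h : S.Nonempty) : √κ ≤ signWeight κ sgn S := by
  refine Real.sqrt_le_sqrt ?_
  have h1 : (1 : ℝ) ≤ S.card := by exact_mod_cast h.card_pos
  nlinarith [Nat.cast_nonneg (α := ℝ) (majority sgn S)]

theorem card_le_signWeight (hκ : 0 ≤ κ) : (S.card : ℝ) ≤ 3 / 2 * signWeight κ sgn S := by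
  have h : (2 / 3 : ℝ) * S.card ≤ signWeight κ sgn S := by
    refine Real.le_sqrt_of_sq_le ?_
    have h1 : (S.card : ℝ) ≤ 2 * majority sgn S := by exact_mod_cast card_le_two_mul_majority
    nlinarith [Nat.cast_nonneg (α := ℝ) (majority sgn S), Nat.cast_nonneg (α := ℝ) S.card]
  linarith

/-- This is what makes the geometric mean useful. Keeping the larger majority `Q` for both sets only
lowers the difference of weights to `√Q * (√N - √n)`. One sign carries at least half of `S`, so `√N
≤ √2 * √Q ≤ 3/2 * √Q`, and `N - n` factors as `(√N - √n) * (√N + √n)`. -/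
theorem card_sub_card_le_signWeight (hκ : 0 ≤ κ) (h : T ⊆ S) :
    (S.card : ℝ) - T.card ≤ 3 * (signWeight κ sgn S - signWeight κ sgn T) := by
  set N : ℝ := (S.card : ℝ) with hNdef
  set n : ℝ := (T.card : ℝ) with hndef
  set Q : ℝ := majority sgn S + κ with hQ
  have hn : 0 ≤ n := Nat.cast_nonneg _
  have hN : n ≤ N := Nat.cast_le.mpr (Finset.card_le_card h)
  have hNQ : N ≤ 2 * Q := by
    have : (S.card : ℝ) ≤ 2 * majority sgn S := by exact_mod_cast card_le_two_mul_majority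
    simp only [hQ, hNdef]; linarith
  have hS : signWeight κ sgn S = √N * √Q := Real.sqrt_mul (hn.trans hN) _
  have hT : signWeight κ sgn T ≤ √n * √Q := by
    rw [← Real.sqrt_mul hn]
    refine Real.sqrt_le_sqrt (mul_le_mul_of_nonneg_left ?_ hn)
    have : (majority sgn T : ℝ) ≤ majority sgn S := by exact_mod_cast majority_mono h
    simp only [hQ]; linarith
  have h1 : √n ≤ √N := Real.sqrt_le_sqrt hN
  have h2 : √N ≤ 3 / 2 * √Q := by
    rw [Real.sqrt_le_left (by positivity), mul_pow, Real.sq_sqrt (by linarith)]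
    linarith
  have h3 : N - n = (√N - √n) * (√N + √n) := by
    nlinarith [Real.sq_sqrt hn, Real.sq_sqrt (hn.trans hN)]
  rw [h3, hS]
  nlinarith [mul_le_mul_of_nonneg_left (by linarith : √N + √n ≤ 3 * √Q) (sub_nonneg.2 h1)]

end Weight

/-! ### Total weight of the pieces produced by one query -/

section Splitting

variable {ι Θ : Type*} [DecidableEq ι] {κ θ : ℝ} {sgn : Θ → Bool}

/-- The left side counts the pieces in which a nonempty set of components ties at the maximum `y`
and the rest lie below. Pieces with one component at `y` telescope in `y` and give the `3`. Multiple
ties are an error term: a level set has at most two elements, which is at most `θ` times the weight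
by the smoothing `κ`. -/
theorem sum_tie_weight_le (hκ : 0 ≤ κ) (hθ : 0 ≤ θ) (hθκ : 2 ≤ θ * √κ) (U : Finset ι)
    (S : ι → Finset Θ) (val : ι → Θ → ℝ)
    (htwo : ∀ j y, ((S j).filter (val j · = y)).card ≤ 2) (Y : Finset ℝ) :
    ∑ y ∈ Y, (∏ j ∈ U, ((((S j).filter (val j · = y)).card : ℝ)
          + signWeight κ sgn ((S j).filter (val j · < y)))
        - ∏ j ∈ U, signWeight κ sgn ((S j).filter (val j · < y)))
      ≤ (3 + 3 / 2 * U.card * ((1 + θ) ^ U.card - 1)) * ∏ j ∈ U, signWeight κ sgn (S j) := by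
  set W : ι → ℝ := fun j => signWeight κ sgn (S j) with hW
  set v : ℝ → ι → ℝ := fun y j => signWeight κ sgn ((S j).filter (val j · < y)) with hv
  set F : ℝ → ι → ℝ := fun y j => signWeight κ sgn ((S j).filter (val j · ≤ y)) with hF
  set N : ℝ → ι → ℝ := fun y j => (((S j).filter (val j · = y)).card : ℝ) with hN
  set δ : ℝ := (1 + θ) ^ U.card - 1 with hδ
  have hδ0 : 0 ≤ δ := by
    linarith [one_le_pow₀ (n := U.card) (by linarith : (1 : ℝ) ≤ 1 + θ)]
  have hW0 : ∀ j, 0 ≤ W j := fun j => signWeight_nonneg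
  have hv0 : ∀ y j, 0 ≤ v y j := fun y j => signWeight_nonneg
  have hF0 : ∀ y j, 0 ≤ F y j := fun y j => signWeight_nonneg
  have hN0 : ∀ y j, 0 ≤ N y j := fun y j => Nat.cast_nonneg _
  have hvW : ∀ y j, v y j ≤ W j := fun y j => signWeight_mono hκ (Finset.filter_subset _ _)
  have hFW : ∀ y j, F y j ≤ W j := fun y j => signWeight_mono hκ (Finset.filter_subset _ _)
  have hvF : ∀ y j, v y j ≤ F y j := fun y j =>
    signWeight_mono hκ (Finset.monotone_filter_right _ fun a _ h => le_of_lt h)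
  have hNθ : ∀ y j, N y j ≤ θ * W j := by
    intro y j
    rcases (S j).eq_empty_or_nonempty with h | h
    · simp [hN, hW, h, signWeight]
    · have h1 : N y j ≤ 2 := by
        simp only [hN]
        exact_mod_cast htwo j y
      exact h1.trans <| hθκ.trans <| mul_le_mul_of_nonneg_left (sqrt_le_signWeight hκ h) hθ
  have hNF : ∀ y j, N y j ≤ 3 * (F y j - v y j) := by
    intro y j
    have hsub : (S j).filter (val j · < y) ⊆ (S j).filter (val j · ≤ y) :=
      Finset.monotone_filter_right _ fun a _ h => le_of_lt h
    have h1 := card_sub_card_le_signWeight (sgn := sgn) hκ hsub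
    have h2 : ((S j).filter (val j · ≤ y)).card
        = ((S j).filter (val j · < y)).card + ((S j).filter (val j · = y)).card := by
      classical
      rw [← Finset.card_union_of_disjoint]
      · congr 1
        ext a
        simp only [Finset.mem_union, Finset.mem_filter, le_iff_lt_or_eq]
        tauto
      · exact Finset.disjoint_filter.2 fun a _ h h' => h.ne h'
    rw [h2] at h1
    push_cast at h1
    simp only [hN, hF, hv]
    linarith
  have herase : ∀ y, ∀ i ∈ U, ∏ j ∈ U.erase i, (N y j + v y j)
      ≤ ∏ j ∈ U.erase i, v y j + δ * ∏ j ∈ U.erase i, W j := by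
    intro y i hi
    calc ∏ j ∈ U.erase i, (N y j + v y j) ≤ ∏ j ∈ U.erase i, (v y j + θ * W j) :=
          Finset.prod_le_prod (fun j _ => add_nonneg (hN0 y j) (hv0 y j))
            fun j _ => by linarith [hNθ y j]
      _ ≤ _ := prod_add_smul_le _ _ _ hθ (fun j _ => hv0 y j) fun j _ => hvW y j
      _ ≤ _ := by
        gcongr
        · exact Finset.prod_nonneg fun j _ => hW0 j
        · rw [hδ]
          gcongr
          · linarith
          · exact Finset.erase_subset _ _
  have hterm : ∀ y, ∏ j ∈ U, (N y j + v y j) - ∏ j ∈ U, v y j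
      ≤ 3 * (∏ j ∈ U, F y j - ∏ j ∈ U, v y j)
        + δ * ∑ i ∈ U, N y i * ∏ j ∈ U.erase i, W j := by
    intro y
    calc _ ≤ ∑ i ∈ U, N y i * ∏ j ∈ U.erase i, (N y j + v y j) :=
          prod_add_sub_prod_le _ _ _ (fun j _ => hv0 y j) fun j _ => hN0 y j
      _ ≤ ∑ i ∈ U, (3 * ((F y i - v y i) * ∏ j ∈ U.erase i, v y j)
            + δ * (N y i * ∏ j ∈ U.erase i, W j)) := by
          refine Finset.sum_le_sum fun i hi => ?_
          have h1 := mul_le_mul_of_nonneg_left (herase y i hi) (hN0 y i)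
          have h2 := mul_le_mul_of_nonneg_right (hNF y i)
            (Finset.prod_nonneg (s := U.erase i) fun j _ => hv0 y j)
          linarith
      _ ≤ _ := by
          rw [Finset.sum_add_distrib, ← Finset.mul_sum, ← Finset.mul_sum]
          have h := sum_mul_prod_erase_le U (v y) (fun j => F y j - v y j) (fun j _ => hv0 y j)
            fun j _ => sub_nonneg.2 (hvF y j)
          simp only [add_sub_cancel] at h
          linarith
  -- Interlacing: for `y < y'`, elements with value at most `y` have value less than `y'`.
  have htel : ∑ y ∈ Y, (∏ j ∈ U, F y j - ∏ j ∈ U, v y j) ≤ ∏ j ∈ U, W j :=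
    sum_sub_le_of_interlaced Y _ _ (fun y => Finset.prod_nonneg fun j _ => hv0 y j)
      (fun y y' hy => Finset.prod_le_prod (fun j _ => hF0 y j) fun j _ =>
        signWeight_mono hκ (Finset.monotone_filter_right _ fun a _ h => lt_of_le_of_lt h hy))
      _ (Finset.prod_nonneg fun j _ => hW0 j)
      fun y _ => Finset.prod_le_prod (fun j _ => hF0 y j) fun j _ => hFW y j
  -- The level sets of one component are disjoint, so their sizes sum to at most the size of `S i`.
  have hties : ∑ y ∈ Y, ∑ i ∈ U, N y i * ∏ j ∈ U.erase i, W j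
      ≤ 3 / 2 * U.card * ∏ j ∈ U, W j := by
    rw [Finset.sum_comm]
    have : ∀ i ∈ U, ∑ y ∈ Y, N y i * ∏ j ∈ U.erase i, W j ≤ 3 / 2 * ∏ j ∈ U, W j := by
      intro i hi
      rw [← Finset.sum_mul, ← Finset.mul_prod_erase U W hi, ← mul_assoc]
      refine mul_le_mul_of_nonneg_right ?_ (Finset.prod_nonneg fun j _ => hW0 j)
      refine le_trans ?_ (card_le_signWeight (sgn := sgn) hκ)
      classical
      simp only [hN]
      rw [← Nat.cast_sum, ← Finset.card_biUnion fun y _ y' _ hne =>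
        Finset.disjoint_filter.2 fun a _ h h' => hne (h.symm.trans h')]
      exact_mod_cast Finset.card_le_card (Finset.biUnion_subset.2 fun y _ =>
        Finset.filter_subset _ _)
    refine (Finset.sum_le_sum this).trans (le_of_eq ?_)
    rw [Finset.sum_const, nsmul_eq_mul]
    ring
  calc _ ≤ ∑ y ∈ Y, (3 * (∏ j ∈ U, F y j - ∏ j ∈ U, v y j)
        + δ * ∑ i ∈ U, N y i * ∏ j ∈ U.erase i, W j) := Finset.sum_le_sum fun y _ => hterm y
    _ ≤ _ := by
      rw [Finset.sum_add_distrib, ← Finset.mul_sum, ← Finset.mul_sum]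
      have := mul_le_mul_of_nonneg_left hties hδ0
      linarith

end Splitting

/-! ### Counting solved parameters box by box -/

section BoxCounting

variable {ι Θ : Type*} [Fintype ι] [DecidableEq ι] {κ θ : ℝ} {sgn : Θ → Bool}

open Classical in
/-- A box is covered by sub-boxes on each of which the components that attain the maximum of the
`val j (ϑ j)` are pinned down, at the cost of a factor `5` in the total weight. -/
theorem card_filter_box_le_of_split (hκ : 0 ≤ κ) (hθ : 0 ≤ θ) (hθκ : 2 ≤ θ * √κ)
    (hcard : 3 / 2 * Fintype.card ι * ((1 + θ) ^ Fintype.card ι - 1) ≤ 1)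
    (U : Finset ι) (S : ι → Finset Θ) (hS : ∀ k ∉ U, (S k).card ≤ 1) (val : ι → Θ → ℝ)
    (htwo : ∀ j y, ((S j).filter (val j · = y)).card ≤ 2) (P : (ι → Θ) → Prop) {C : ℝ}
    (hC : 0 ≤ C)
    (h : ∀ (U' : Finset ι) (S' : ι → Finset Θ), (∀ j, S' j ⊆ S j) →
      (∀ k ∉ U', (S' k).card ≤ 1) →
      (∀ ϑ ∈ Fintype.piFinset S', ∀ j ∈ U', ∃ k ∉ U', val j (ϑ j) < val k (ϑ k)) →
      (((Fintype.piFinset S').filter P).card : ℝ) ≤ C * ∏ j ∈ U', signWeight κ sgn (S' j)) :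
    (((Fintype.piFinset S).filter P).card : ℝ) ≤ 5 * C * ∏ j ∈ U, signWeight κ sgn (S j) := by
  set W := ∏ j ∈ U, signWeight κ sgn (S j) with hW
  have hW0 : 0 ≤ W := Finset.prod_nonneg fun j _ => signWeight_nonneg
  -- no unknown component exceeds all the known ones
  let SA : ι → Finset Θ := fun j =>
    if j ∈ U then (S j).filter (fun t => ∃ k ∉ U, ∃ t' ∈ S k, val j t < val k t') else S j
  have hSA : ∀ j, SA j ⊆ S j := by
    intro j
    by_cases hj : j ∈ U
    · simp only [SA, hj, if_true]; exact Finset.filter_subset _ _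
    · simp [SA, hj]
  have hA : (((Fintype.piFinset SA).filter P).card : ℝ) ≤ C * W := by
    refine (h U SA hSA (fun k hk => by simpa [SA, hk] using hS k hk) ?_).trans ?_
    · intro ϑ hϑ j hj
      rw [Fintype.mem_piFinset] at hϑ
      have h1 := hϑ j
      simp only [SA, hj, if_true, Finset.mem_filter] at h1
      obtain ⟨_, k, hk, t', ht', hlt⟩ := h1
      have h2 := hSA k (hϑ k)
      exact ⟨k, hk, by rwa [Finset.card_le_one.1 (hS k hk) _ h2 _ ht']⟩
    · refine mul_le_mul_of_nonneg_left ?_ hC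
      exact Finset.prod_le_prod (fun j _ => signWeight_nonneg)
        fun j _ => signWeight_mono hκ (hSA j)
  -- the unknown components in `I` are tied for the maximum `y`
  let N : ℝ → ι → Finset Θ := fun y j => (S j).filter (val j · = y)
  let L : ℝ → ι → Finset Θ := fun y j => (S j).filter (val j · < y)
  let SB : ℝ → (I : Finset ι) → ((j : ι) → j ∈ I → Θ) → ι → Finset Θ := fun y I g j =>
    if hj : j ∈ I then {g j hj} else if j ∈ U then L y j else S j
  have hB : ∀ y, ∀ I ∈ U.powerset.erase ∅, ∀ g ∈ I.pi (N y),
      (((Fintype.piFinset (SB y I g)).filter P).card : ℝ)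
        ≤ C * ∏ j ∈ U \ I, signWeight κ sgn (L y j) := by
    intro y I hI g hg
    rw [Finset.mem_erase, Finset.mem_powerset] at hI
    rw [Finset.mem_pi] at hg
    have hgI : ∀ j (hj : j ∈ I), g j hj ∈ S j ∧ val j (g j hj) = y := fun j hj => by
      simpa [N] using hg j hj
    have hSB : ∀ j ∈ U \ I, SB y I g j = L y j := by
      intro j hj
      rw [Finset.mem_sdiff] at hj
      simp [SB, hj.1, hj.2]
    refine (h (U \ I) (SB y I g) ?_ ?_ ?_).trans (le_of_eq ?_)
    · intro j
      by_cases hj : j ∈ I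
      · simpa [SB, hj] using (hgI j hj).1
      · by_cases hjU : j ∈ U
        · simp [SB, hj, hjU, L]
        · simp [SB, hj, hjU]
    · intro k hk
      by_cases hj : k ∈ I
      · simp [SB, hj]
      · have hkU : k ∉ U := fun hkU => hk (Finset.mem_sdiff.2 ⟨hkU, hj⟩)
        simpa [SB, hj, hkU] using hS k hkU
    · intro ϑ hϑ j hj
      rw [Fintype.mem_piFinset] at hϑ
      obtain ⟨i, hi⟩ := Finset.nonempty_iff_ne_empty.2 hI.1
      refine ⟨i, fun hi' => (Finset.mem_sdiff.1 hi').2 hi, ?_⟩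
      have h1 := hϑ j
      rw [hSB j hj] at h1
      have h2 : ϑ i = g i hi := by simpa [SB, hi] using hϑ i
      rw [h2, (hgI i hi).2]
      exact (Finset.mem_filter.1 h1).2
    · rw [Finset.prod_congr rfl fun j hj => by rw [hSB j hj]]
  let Y : Finset ℝ := U.biUnion fun j => (S j).image (val j)
  have hcover : (Fintype.piFinset S).filter P ⊆ (Fintype.piFinset SA).filter P ∪
      Y.biUnion fun y => (U.powerset.erase ∅).biUnion fun I => (I.pi (N y)).biUnion fun g =>
        (Fintype.piFinset (SB y I g)).filter P := by
    intro ϑ hϑ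
    obtain ⟨hϑS, hP⟩ := Finset.mem_filter.1 hϑ
    rw [Fintype.mem_piFinset] at hϑS
    by_cases hcase : ∀ j ∈ U, ∃ k ∉ U, val j (ϑ j) < val k (ϑ k)
    · refine Finset.mem_union_left _ (Finset.mem_filter.2 ⟨?_, hP⟩)
      rw [Fintype.mem_piFinset]
      intro j
      by_cases hj : j ∈ U
      · simp only [SA, hj, if_true, Finset.mem_filter]
        obtain ⟨k, hk, hlt⟩ := hcase j hj
        exact ⟨hϑS j, k, hk, ϑ k, hϑS k, hlt⟩
      · simpa [SA, hj] using hϑS j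
    · refine Finset.mem_union_right _ ?_
      push Not at hcase
      obtain ⟨j₀, hj₀, -⟩ := hcase
      obtain ⟨i, hi, himax⟩ := U.exists_max_image (fun j => val j (ϑ j)) ⟨j₀, hj₀⟩
      have hiI : i ∈ U.filter fun j => val j (ϑ j) = val i (ϑ i) := by simp [hi]
      simp only [Finset.mem_biUnion]
      refine ⟨val i (ϑ i), ?_, U.filter fun j => val j (ϑ j) = val i (ϑ i), ?_,
        fun j _ => ϑ j, ?_, ?_⟩
      · exact Finset.mem_biUnion.2 ⟨i, hi, Finset.mem_image_of_mem _ (hϑS i)⟩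
      · exact Finset.mem_erase.2 ⟨Finset.ne_empty_of_mem hiI,
          Finset.mem_powerset.2 (Finset.filter_subset _ _)⟩
      · rw [Finset.mem_pi]
        exact fun j hj => Finset.mem_filter.2 ⟨hϑS j, (Finset.mem_filter.1 hj).2⟩
      · refine Finset.mem_filter.2 ⟨?_, hP⟩
        rw [Fintype.mem_piFinset]
        intro j
        by_cases hjI : j ∈ U.filter fun j => val j (ϑ j) = val i (ϑ i)
        · simp only [SB, hjI, dif_pos, Finset.mem_singleton]
        · by_cases hj : j ∈ U
          · have hne : val j (ϑ j) ≠ val i (ϑ i) := fun he =>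
              hjI (Finset.mem_filter.2 ⟨hj, he⟩)
            simp only [SB, hjI, hj, dif_neg, if_true, not_false_eq_true, L, Finset.mem_filter]
            exact ⟨hϑS j, lt_of_le_of_ne (himax j hj) hne⟩
          · simpa only [SB, hjI, hj, dif_neg, if_false, not_false_eq_true] using hϑS j
  have hsum : (((Fintype.piFinset S).filter P).card : ℝ) ≤
      ((Fintype.piFinset SA).filter P).card + ∑ y ∈ Y, ∑ I ∈ U.powerset.erase ∅,
        ∑ g ∈ I.pi (N y), (((Fintype.piFinset (SB y I g)).filter P).card : ℝ) := by
    have h1 := (Finset.card_le_card hcover).trans (Finset.card_union_le _ _)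
    have h2 := h1.trans (Nat.add_le_add_left (Finset.card_biUnion_le.trans
      (Finset.sum_le_sum fun y _ => Finset.card_biUnion_le.trans
        (Finset.sum_le_sum fun I _ => Finset.card_biUnion_le))) _)
    exact_mod_cast h2
  -- The sum over tie sets `I` is the expansion of `∏ (N + w)`; the subtracted product is its term
  -- `I = ∅`.
  have htie : ∀ y, ∑ I ∈ U.powerset.erase ∅,
        ∑ g ∈ I.pi (N y), (((Fintype.piFinset (SB y I g)).filter P).card : ℝ)
      ≤ C * (∏ j ∈ U, (((N y j).card : ℝ) + signWeight κ sgn (L y j))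
        - ∏ j ∈ U, signWeight κ sgn (L y j)) := by
    intro y
    rw [Finset.prod_add, ← Finset.add_sum_erase _ _ (Finset.empty_mem_powerset U)]
    simp only [Finset.prod_empty, Finset.sdiff_empty, one_mul, add_sub_cancel_left]
    rw [Finset.mul_sum]
    refine Finset.sum_le_sum fun I hI => ?_
    refine (Finset.sum_le_sum fun g hg => hB y I hI g hg).trans (le_of_eq ?_)
    rw [Finset.sum_const, Finset.card_pi, nsmul_eq_mul]
    push_cast
    ring
  have hUcard : U.card ≤ Fintype.card ι := Finset.card_le_univ U
  have hU : 3 / 2 * (U.card : ℝ) * ((1 + θ) ^ U.card - 1) ≤ 1 := by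
    refine le_trans ?_ hcard
    have h1 : (1 : ℝ) ≤ (1 + θ) ^ U.card := one_le_pow₀ (by linarith)
    have h2 : (1 + θ) ^ U.card ≤ (1 + θ) ^ Fintype.card ι :=
      pow_le_pow_right₀ (by linarith) hUcard
    have h3 : (U.card : ℝ) ≤ Fintype.card ι := by exact_mod_cast hUcard
    refine mul_le_mul ?_ (by linarith) (by linarith) (by positivity)
    linarith
  -- The `5` is `1` for the box `SA`, `3` for the telescoping part and `1` for the multiple ties.
  have htotal := (Finset.sum_le_sum fun y (_ : y ∈ Y) => htie y)
  rw [← Finset.mul_sum] at htotal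
  have hw := mul_le_mul_of_nonneg_left
    (sum_tie_weight_le (sgn := sgn) hκ hθ hθκ U S val htwo Y) hC
  have hfin := mul_le_mul_of_nonneg_left hU (mul_nonneg hC hW0)
  rw [← hW] at hw
  linarith

/-- A function of `x` cannot predict the signs on a box better than by majority. -/
theorem card_filter_sgn_box_le [DecidableEq Θ] (hκ : 0 ≤ κ) (U : Finset ι) (S : ι → Finset Θ)
    (hS : ∀ k ∉ U, (S k).card ≤ 1) (g : ι → Bool) :
    (((Fintype.piFinset S).filter fun ϑ => ∀ j, sgn (ϑ j) = g j).card : ℝ)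
      ≤ ∏ j ∈ U, signWeight κ sgn (S j) := by
  have h1 : ((Fintype.piFinset S).filter fun ϑ => ∀ j, sgn (ϑ j) = g j)
      = Fintype.piFinset fun j => (S j).filter (sgn · = g j) := by
    ext ϑ
    simp only [Finset.mem_filter, Fintype.mem_piFinset]
    exact forall_and.symm
  rw [h1, Fintype.card_piFinset]
  push_cast
  rw [← Finset.prod_mul_prod_compl U]
  have h2 : ∏ j ∈ Uᶜ, (((S j).filter (sgn · = g j)).card : ℝ) ≤ 1 := by
    refine Finset.prod_le_one (fun _ _ => Nat.cast_nonneg _) fun j hj => ?_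
    exact_mod_cast (Finset.card_filter_le _ _).trans (hS j (Finset.mem_compl.1 hj))
  have h3 : ∏ j ∈ U, (((S j).filter (sgn · = g j)).card : ℝ)
      ≤ ∏ j ∈ U, signWeight κ sgn (S j) := by
    refine Finset.prod_le_prod (fun _ _ => Nat.cast_nonneg _) fun j _ => ?_
    refine le_trans ?_ (majority_le_signWeight hκ)
    exact_mod_cast card_filter_sgn_le _
  calc _ ≤ (∏ j ∈ U, (((S j).filter (sgn · = g j)).card : ℝ)) * 1 :=
        mul_le_mul_of_nonneg_left h2 (Finset.prod_nonneg fun _ _ => Nat.cast_nonneg _)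
    _ ≤ _ := by rwa [mul_one]

variable {X R : Type*}

/-- One of the outputs of `A` after `s, …, s + t` queries is good. -/
def OracleAlg.FindsWithin (A : OracleAlg X R) (a : X → R) (good : X → Prop) (s t : ℕ) : Prop :=
  ∃ i ≤ t, good (A.output (A.transcript a (s + i)))

open Classical in
-- Induction on the remaining queries, over all boxes with a common transcript. On such a box the
-- current output is fixed, so it succeeds on at most the weight. The next query is fixed too; on
-- each piece it creates, locality makes the answer constant, so the induction hypothesis applies.
-- Each step costs `1 + 5 = 6`.
theorem OracleAlg.card_filter_success_le (A : OracleAlg X R) (hκ : 0 ≤ κ) (hθ : 0 ≤ θ)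
    (hθκ : 2 ≤ θ * √κ)
    (hcard : 3 / 2 * Fintype.card ι * ((1 + θ) ^ Fintype.card ι - 1) ≤ 1)
    (val : X → ι → Θ → ℝ)
    (htwo : ∀ x j y (T : Finset Θ), (T.filter (val x j · = y)).card ≤ 2)
    (a : (ι → Θ) → X → R)
    (hlocal : ∀ x (U : Finset ι) (ϑ ϑ' : ι → Θ), (∀ k ∉ U, ϑ k = ϑ' k) →
      (∀ j ∈ U, ∃ k ∉ U, val x j (ϑ j) < val x k (ϑ k)) →
      (∀ j ∈ U, ∃ k ∉ U, val x j (ϑ' j) < val x k (ϑ' k)) → a ϑ x = a ϑ' x)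
    (succ : (ι → Θ) → X → Prop) (guess : X → ι → Bool)
    (hguess : ∀ ϑ x, succ ϑ x → ∀ j, sgn (ϑ j) = guess x j) (t : ℕ) :
    ∀ (s : ℕ) (U : Finset ι) (S : ι → Finset Θ), (∀ k ∉ U, (S k).card ≤ 1) →
      (∃ h, ∀ ϑ ∈ Fintype.piFinset S, A.transcript (a ϑ) s = h) →
      (((Fintype.piFinset S).filter fun ϑ =>
          A.FindsWithin (a ϑ) (succ ϑ) s t).card : ℝ)
        ≤ 6 ^ t * ∏ j ∈ U, signWeight κ sgn (S j) := by
  have hbase : ∀ (s : ℕ) (U : Finset ι) (S : ι → Finset Θ), (∀ k ∉ U, (S k).card ≤ 1) →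
      (∃ h, ∀ ϑ ∈ Fintype.piFinset S, A.transcript (a ϑ) s = h) →
      (((Fintype.piFinset S).filter fun ϑ => succ ϑ (A.output (A.transcript (a ϑ) s))).card : ℝ)
        ≤ ∏ j ∈ U, signWeight κ sgn (S j) := by
    rintro s U S hS ⟨h, hh⟩
    refine le_trans ?_ (card_filter_sgn_box_le (sgn := sgn) hκ U S hS (guess (A.output h)))
    refine Nat.cast_le.2 (Finset.card_le_card fun ϑ hϑ => ?_)
    obtain ⟨hϑS, hsucc⟩ := Finset.mem_filter.1 hϑ
    rw [hh ϑ hϑS] at hsucc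
    exact Finset.mem_filter.2 ⟨hϑS, hguess _ _ hsucc⟩
  induction t with
  | zero =>
    intro s U S hS hh
    simpa [OracleAlg.FindsWithin] using hbase s U S hS hh
  | succ t ih =>
    intro s U S hS hh
    have h0 := hbase s U S hS hh
    obtain ⟨h, hh⟩ := hh
    have hsplit := card_filter_box_le_of_split (sgn := sgn) hκ hθ hθκ hcard U S hS
      (val (A.query h)) (fun j y => htwo _ j y _)
      (fun ϑ => A.FindsWithin (a ϑ) (succ ϑ) (s + 1) t)
      (C := 6 ^ t) (by positivity) fun U' S' hsub hS' hsep => by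
        refine ih (s + 1) U' S' hS' ?_
        -- On an empty box any transcript serves; otherwise compare with one parameter of the box.
        rcases (Fintype.piFinset S').eq_empty_or_nonempty with he | ⟨ϑ₀, hϑ₀⟩
        · exact ⟨[], fun ϑ hϑ => by simp [he] at hϑ⟩
        · refine ⟨A.transcript (a ϑ₀) (s + 1), fun ϑ hϑ => ?_⟩
          have hS0 := hh ϑ₀ (Fintype.piFinset_subset _ _ hsub hϑ₀)
          have hS1 := hh ϑ (Fintype.piFinset_subset _ _ hsub hϑ)
          simp only [OracleAlg.transcript, hS0, hS1]
          rw [hlocal (A.query h) U' ϑ ϑ₀ (fun k hk => ?_) (hsep ϑ hϑ) (hsep ϑ₀ hϑ₀)]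
          exact Finset.card_le_one.1 (hS' k hk) _ (Fintype.mem_piFinset.1 hϑ k) _
            (Fintype.mem_piFinset.1 hϑ₀ k)
    have hunion : ((Fintype.piFinset S).filter fun ϑ =>
          A.FindsWithin (a ϑ) (succ ϑ) s (t + 1)) ⊆
        ((Fintype.piFinset S).filter fun ϑ => succ ϑ (A.output (A.transcript (a ϑ) s))) ∪
        ((Fintype.piFinset S).filter fun ϑ =>
          A.FindsWithin (a ϑ) (succ ϑ) (s + 1) t) := by
      intro ϑ hϑ
      obtain ⟨hϑS, i, hi, hsucc⟩ := Finset.mem_filter.1 hϑ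
      rcases i with _ | i
      · exact Finset.mem_union_left _ (Finset.mem_filter.2 ⟨hϑS, hsucc⟩)
      · refine Finset.mem_union_right _ (Finset.mem_filter.2 ⟨hϑS, i, by omega, ?_⟩)
        rwa [show s + 1 + i = s + (i + 1) by omega]
    have hle : (((Fintype.piFinset S).filter fun ϑ =>
          A.FindsWithin (a ϑ) (succ ϑ) s (t + 1)).card : ℝ) ≤
        ((Fintype.piFinset S).filter fun ϑ => succ ϑ (A.output (A.transcript (a ϑ) s))).card +
        ((Fintype.piFinset S).filter fun ϑ =>
          A.FindsWithin (a ϑ) (succ ϑ) (s + 1) t).card := by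
      rw [← Nat.cast_add]
      exact Nat.cast_le.2 ((Finset.card_le_card hunion).trans (Finset.card_union_le _ _))
    have hW0 : 0 ≤ ∏ j ∈ U, signWeight κ sgn (S j) :=
      Finset.prod_nonneg fun j _ => signWeight_nonneg
    have h6 : (1 : ℝ) ≤ 6 ^ t := one_le_pow₀ (by norm_num)
    rw [pow_succ]
    have h7 := mul_le_mul_of_nonneg_right h6 hW0
    generalize ∏ j ∈ U, signWeight κ sgn (S j) = W at *
    refine hle.trans ((add_le_add h0 hsplit).trans ?_)
    linarith

end BoxCounting

/-! ### Choice of the number of levels -/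

section Parameters

/-- Since `(1 + θ)^M * (1 - θ)^M ≤ 1`, Bernoulli's inequality gives the bound `1 / (1 - M * θ)`. -/
theorem one_add_pow_le_one_add_two_mul {θ : ℝ} {M : ℕ} (hθ : 0 ≤ θ) (h : M * θ ≤ 1 / 2) :
    (1 + θ) ^ M ≤ 1 + 2 * (M * θ) := by
  rcases Nat.eq_zero_or_pos M with rfl | hM
  · simp
  have hM' : (1 : ℝ) ≤ M := by exact_mod_cast hM
  have hθ1 : θ ≤ 1 / 2 := by nlinarith
  have h1 : 1 - M * θ ≤ (1 - θ) ^ M := by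
    have := one_add_mul_le_pow (a := -θ) (by linarith) M
    simpa [sub_eq_add_neg] using this
  have h2 : (1 + θ) ^ M * (1 - θ) ^ M ≤ 1 := by
    rw [← mul_pow]
    exact pow_le_one₀ (by nlinarith) (by nlinarith)
  have h3 : 0 ≤ (1 + θ) ^ M := by positivity
  have h4 : (1 + θ) ^ M * (1 - M * θ) ≤ 1 := (mul_le_mul_of_nonneg_left h1 h3).trans h2
  have h0 : 0 ≤ M * θ := by positivity
  by_contra! hlt
  nlinarith

theorem six_pow_le_rpow {t M : ℕ} (h : 12 * t ≤ M) : (6 : ℝ) ^ t ≤ 2 ^ ((M : ℝ) / 4) := by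
  calc (6 : ℝ) ^ t ≤ 8 ^ t := pow_le_pow_left₀ (by norm_num) (by norm_num) t
    _ = (2 : ℝ) ^ ((3 * t : ℕ) : ℝ) := by
      rw [Real.rpow_natCast, pow_mul]; norm_num
    _ ≤ 2 ^ ((M : ℝ) / 4) := by
      refine Real.rpow_le_rpow_of_exponent_le (by norm_num) ?_
      have : (12 * t : ℝ) ≤ M := by exact_mod_cast h
      push_cast
      linarith

open Classical in
/-- If `K` is large compared with the number of components, an algorithm identifies all the signs
within `card ι / 12` queries only for an exponentially small fraction of the parameters. -/
theorem exists_levels_card_success_le (ι : Type*) [Fintype ι] [DecidableEq ι] [Nonempty ι] :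
    ∃ K : ℕ, 0 < K ∧ ∀ (X : Type*) (R : Type*) (A : OracleAlg X R)
      (val : X → ι → Bool × Fin K → ℝ)
      (_ : ∀ x j y (T : Finset (Bool × Fin K)), (T.filter (val x j · = y)).card ≤ 2)
      (a : (ι → Bool × Fin K) → X → R)
      (_ : ∀ x (U : Finset ι) (ϑ ϑ' : ι → Bool × Fin K), (∀ k ∉ U, ϑ k = ϑ' k) →
        (∀ j ∈ U, ∃ k ∉ U, val x j (ϑ j) < val x k (ϑ k)) →
        (∀ j ∈ U, ∃ k ∉ U, val x j (ϑ' j) < val x k (ϑ' k)) → a ϑ x = a ϑ' x)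
      (succ : (ι → Bool × Fin K) → X → Prop) (guess : X → ι → Bool)
      (_ : ∀ ϑ x, succ ϑ x → ∀ j, (ϑ j).1 = guess x j) (t : ℕ) (_ : 12 * t ≤ Fintype.card ι),
      ((Finset.univ.filter fun ϑ => A.FindsWithin (a ϑ) (succ ϑ) 0 t).card : ℝ)
        ≤ 2 * 2 ^ (-(Fintype.card ι : ℝ) / 4) * Fintype.card (ι → Bool × Fin K) := by
  set M := Fintype.card ι with hM
  have hM1 : (1 : ℝ) ≤ M := by exact_mod_cast Fintype.card_pos (α := ι)
  -- With `θ = 1 / (3 * M ^ 2)` the error of multiple ties is at most `1`; `κ = 36 * M ^ 4` then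
  -- makes `θ * √κ = 2`. The choice `K = M * κ` leaves a smoothing factor `√(1 + 1/M)` per
  -- component, whose `M`-th power is at most `2`.
  obtain ⟨K, hK⟩ : ∃ K, K = 36 * M ^ 5 := ⟨_, rfl⟩
  refine ⟨K, by have := Fintype.card_pos (α := ι); subst hK; positivity, ?_⟩
  intro X R A val htwo a hlocal succ guess hguess t ht
  have hκ : (0 : ℝ) ≤ 36 * M ^ 4 := by positivity
  have hθ : (0 : ℝ) ≤ 1 / (3 * M ^ 2) := by positivity
  have hsqrt : √(36 * (M : ℝ) ^ 4) = 6 * M ^ 2 := by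
    rw [show 36 * (M : ℝ) ^ 4 = (6 * M ^ 2) ^ 2 by ring, Real.sqrt_sq (by positivity)]
  have hcount := A.card_filter_success_le (sgn := (Prod.fst : Bool × Fin K → Bool)) hκ hθ
    (by rw [hsqrt]; field_simp; norm_num) (by
      have h1 : (M : ℝ) * (1 / (3 * M ^ 2)) ≤ 1 / 2 := by
        field_simp
        nlinarith
      have h2 := one_add_pow_le_one_add_two_mul hθ h1
      have h3 : 3 / 2 * (M : ℝ) * ((1 + 1 / (3 * M ^ 2)) ^ M - 1)
          ≤ 3 / 2 * (M : ℝ) * (2 * (M * (1 / (3 * M ^ 2)))) := by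
        gcongr; linarith
      refine h3.trans (le_of_eq ?_)
      field_simp) val htwo a hlocal succ guess hguess t 0 Finset.univ (fun _ => Finset.univ)
    (fun k hk => absurd (Finset.mem_univ k) hk) ⟨[], fun _ _ => rfl⟩
  rw [Fintype.piFinset_univ] at hcount
  refine hcount.trans ?_
  have hKpos : (0 : ℝ) < K := by rw [hK]; push_cast; positivity
  have hw : signWeight (36 * (M : ℝ) ^ 4) (Prod.fst : Bool × Fin K → Bool) Finset.univ
      ≤ √2 * K * (1 + 1 / (2 * M)) := by
    have hmaj : majority (Prod.fst : Bool × Fin K → Bool) Finset.univ = K := by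
      have : ∀ b : Bool, ((Finset.univ : Finset (Bool × Fin K)).filter (·.1 = b)).card = K := by
        intro b
        have : (Finset.univ : Finset (Bool × Fin K)).filter (·.1 = b)
            = {b} ×ˢ Finset.univ := by ext ⟨c, i⟩; simp [eq_comm]
        rw [this]; simp
      simp [majority, this]
    have hx : (0 : ℝ) ≤ 1 / M := by positivity
    have h1 : √(1 + 1 / (M : ℝ)) ≤ 1 + 1 / M / 2 := Real.sqrt_one_add_le (by linarith)
    have h2 : ((Finset.univ : Finset (Bool × Fin K)).card : ℝ)
        * (majority (Prod.fst : Bool × Fin K → Bool) Finset.univ + 36 * (M : ℝ) ^ 4)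
        = 2 * (K : ℝ) ^ 2 * (1 + 1 / M) := by
      rw [hmaj]
      simp only [Finset.card_univ, Fintype.card_prod, Fintype.card_bool, Fintype.card_fin]
      push_cast [hK]
      field_simp
    rw [signWeight, h2, Real.sqrt_mul (by positivity), Real.sqrt_mul (by norm_num),
      Real.sqrt_sq hKpos.le]
    gcongr
    refine h1.trans (le_of_eq ?_)
    field_simp
  have hprod : ∏ _j : ι, signWeight (36 * (M : ℝ) ^ 4) (Prod.fst : Bool × Fin K → Bool)
      Finset.univ ≤ 2 * (√2 ^ M * (K : ℝ) ^ M) := by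
    rw [Finset.prod_const, Finset.card_univ, ← hM]
    refine (pow_le_pow_left₀ signWeight_nonneg hw M).trans ?_
    rw [mul_pow, mul_pow]
    have h1 : (1 + 1 / (2 * (M : ℝ))) ^ M ≤ 2 := by
      have h2 : (M : ℝ) * (1 / (2 * M)) = 1 / 2 := by field_simp
      have := one_add_pow_le_one_add_two_mul (θ := 1 / (2 * (M : ℝ))) (by positivity) h2.le
      rw [h2] at this
      linarith
    have h3 : 0 ≤ √2 ^ M * (K : ℝ) ^ M := by positivity
    nlinarith [mul_le_mul_of_nonneg_left h1 h3]
  have hcardΘ : (Fintype.card (ι → Bool × Fin K) : ℝ) = 2 ^ M * (K : ℝ) ^ M := by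
    simp [← hM, mul_pow]
  rw [hcardΘ]
  calc (6 : ℝ) ^ t * _ ≤ 2 ^ ((M : ℝ) / 4) * (2 * (√2 ^ M * (K : ℝ) ^ M)) := by
        gcongr
        · exact Finset.prod_nonneg fun _ _ => signWeight_nonneg
        · exact six_pow_le_rpow ht
    _ = _ := by
      have h1 : √2 ^ M = (2 : ℝ) ^ ((M : ℝ) / 2) := by
        rw [Real.sqrt_eq_rpow, ← Real.rpow_natCast, ← Real.rpow_mul (by norm_num)]
        congr 1; ring
      have h2 : (2 : ℝ) ^ M = 2 ^ ((M : ℝ)) := (Real.rpow_natCast _ _).symm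
      have h3 : (2 : ℝ) ^ ((M : ℝ) / 4) * 2 ^ ((M : ℝ) / 2)
          = 2 ^ (-(M : ℝ) / 4) * 2 ^ ((M : ℝ)) := by
        rw [← Real.rpow_add (by norm_num), ← Real.rpow_add (by norm_num)]
        congr 1; ring
      rw [h1, h2]
      linear_combination 2 * (K : ℝ) ^ M * h3

end Parameters

/-! ### Functionals whose signs can all be met in the unit ball -/

section Functionals

/-- Sylvester's construction by Kronecker products. -/
theorem exists_isHadamard_two_pow (k : ℕ) :
    ∃ A : Matrix (Fin (2 ^ k)) (Fin (2 ^ k)) ℝ, A.IsHadamard := by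
  induction k with
  | zero =>
    refine ⟨1, Matrix.IsHadamard.of_mul_conjTranspose ?_ ?_ ?_⟩
    · intro i j
      have : i = j := Subsingleton.elim (α := Fin 1) i j
      subst this
      simp
    · simp
    · exact isRegular_iff_ne_zero.2 (by simp)
  | succ k ih =>
    obtain ⟨A, hA⟩ := ih
    have hB : (!![1, 1; 1, -1] : Matrix (Fin 2) (Fin 2) ℝ).IsHadamard := by
      refine Matrix.IsHadamard.of_mul_conjTranspose ?_ ?_ ?_
      · intro i j
        fin_cases i <;> fin_cases j <;> simp [Unitary.mem_iff]
      · ext i j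
        fin_cases i <;> fin_cases j <;>
          norm_num [Matrix.mul_apply, Fin.sum_univ_two, Matrix.conjTranspose_apply]
      · exact isRegular_iff_ne_zero.2 (by simp)
    have e : Fin (2 ^ k) × Fin 2 ≃ Fin (2 ^ (k + 1)) :=
      finProdFinEquiv.trans (finCongr (pow_succ 2 k).symm)
    exact ⟨_, (hA.kronecker hB).reindex e e⟩

/-- The power mean inequality with exponent `2 / P ≥ 1`, applied to the numbers `|w v| ^ P`. -/
theorem sum_rpow_le_of_one_le_of_le_two {κ : Type*} [Fintype κ] [Nonempty κ] {P : ℝ} (hP : 1 ≤ P)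
    (hP2 : P ≤ 2) (w : κ → ℝ) :
    ∑ v, |w v| ^ P ≤ (Fintype.card κ : ℝ) ^ (1 - P / 2) * (∑ v, w v ^ 2) ^ (P / 2) := by
  have hP0 : 0 < P := by linarith
  have hM : (0 : ℝ) < Fintype.card κ := by exact_mod_cast Fintype.card_pos
  have h := Real.rpow_sum_le_const_mul_sum_rpow Finset.univ (fun v => |w v| ^ P)
    (p := 2 / P) ((one_le_div hP0).2 hP2)
  have h0 : ∀ v, |(|w v| ^ P)| = |w v| ^ P := fun v => abs_of_nonneg (by positivity)
  have h1 : ∀ v, (|w v| ^ P) ^ (2 / P) = w v ^ 2 := fun v => by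
    rw [← Real.rpow_mul (abs_nonneg _), mul_div_cancel₀ _ hP0.ne', Real.rpow_two, sq_abs]
  simp only [h0, h1, Finset.card_univ] at h
  have hs : 0 ≤ ∑ v, |w v| ^ P := Finset.sum_nonneg fun v _ => by positivity
  have hs2 : 0 ≤ ∑ v, w v ^ 2 := Finset.sum_nonneg fun v _ => by positivity
  have h2 := Real.rpow_le_rpow (by positivity) h (by positivity : 0 ≤ P / 2)
  rw [← Real.rpow_mul hs, Real.mul_rpow (by positivity) hs2, ← Real.rpow_mul hM.le] at h2
  have h3 : 2 / P * (P / 2) = 1 := by field_simp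
  have h4 : (2 / P - 1) * (P / 2) = 1 - P / 2 := by field_simp
  rwa [h3, h4, Real.rpow_one] at h2

/-- `M` functionals on `ℝ^M` of dual `ℓ^P` norm at most one such that, whatever their signs, their
maximum can be pushed down to `-M^(-1/r)`, `r = max P 2`, in the unit ball. -/
theorem exists_matrix_of_signs {P : ℝ} (hP : 1 ≤ P) (k : ℕ) :
    ∃ A : Matrix (Fin (2 ^ k)) (Fin (2 ^ k)) ℝ,
      (∀ i (y : Fin (2 ^ k) → ℝ), |∑ v, A i v * y v| ≤ (∑ v, |y v| ^ P) ^ (1 / P)) ∧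
      ∀ σ : Fin (2 ^ k) → ℝ, (∀ i, σ i * σ i = 1) → ∃ y : Fin (2 ^ k) → ℝ,
        ∑ v, |y v| ^ P ≤ 1 ∧
          ∀ i, σ i * ∑ v, A i v * y v = -((2 ^ k : ℕ) : ℝ) ^ (-(1 / max P 2)) := by
  have hP0 : 0 < P := by linarith
  have hM : (0 : ℝ) < (2 ^ k : ℕ) := by positivity
  have habs : ∀ σ : ℝ, σ * σ = 1 → |σ| = 1 := fun σ h => by
    rcases mul_self_eq_one_iff.1 h with h | h <;> simp [h]
  rcases le_total 2 P with h2 | h2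
  -- For `P ≥ 2` the coordinate functionals suffice.
  · refine ⟨1, fun i y => ?_, fun σ hσ => ?_⟩
    · simp only [Matrix.one_apply, ite_mul, one_mul, zero_mul, Finset.sum_ite_eq,
        Finset.mem_univ, if_true]
      calc |y i| = (|y i| ^ P) ^ (1 / P) := by
            rw [← Real.rpow_mul (abs_nonneg _), mul_one_div_cancel hP0.ne', Real.rpow_one]
        _ ≤ _ := Real.rpow_le_rpow (by positivity)
            (Finset.single_le_sum (f := fun v => |y v| ^ P) (fun v _ => by positivity)
              (Finset.mem_univ i)) (by positivity)
    · set M : ℝ := ((2 ^ k : ℕ) : ℝ) with hMdef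
      refine ⟨fun i => -(σ i * M ^ (-(1 / P))), ?_, fun i => ?_⟩
      · have h1 : ∀ v, |-(σ v * M ^ (-(1 / P)))| ^ P = M⁻¹ := fun v => by
          rw [abs_neg, abs_mul, habs _ (hσ v), one_mul, abs_of_nonneg (by positivity),
            ← Real.rpow_mul hM.le, ← Real.rpow_neg_one]
          congr 1
          field_simp
        simp only [h1, Finset.sum_const, Finset.card_univ, Fintype.card_fin, nsmul_eq_mul]
        rw [← hMdef, mul_inv_cancel₀ hM.ne']
      · simp only [Matrix.one_apply, ite_mul, one_mul, zero_mul, Finset.sum_ite_eq,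
          Finset.mem_univ, if_true, max_eq_left h2]
        linear_combination (-M ^ (-(1 / P))) * hσ i
  · obtain ⟨H, hH⟩ := exists_isHadamard_two_pow k
    set M : ℝ := ((2 ^ k : ℕ) : ℝ) with hMdef
    have hH1 : ∀ i v, H i v * H i v = 1 := fun i v => by
      have := hH.apply_mem i v
      rw [Unitary.mem_iff] at this
      simpa using this.1
    have hrow : ∀ i j, ∑ v, H i v * H j v = if i = j then M else 0 := fun i j => by
      have := congrFun (congrFun hH.mul_conjTranspose i) j
      simpa [Matrix.mul_apply, Matrix.smul_apply, Matrix.one_apply, hMdef] using this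
    -- For `P ≤ 2`, rows of a Hadamard matrix, scaled to dual norm one by Hölder's inequality.
    refine ⟨M ^ (1 / P - 1) • H, fun i y => ?_, fun σ hσ => ?_⟩
    · have h1 : ∑ v, (M ^ (1 / P - 1) • H) i v * y v = M ^ (1 / P - 1) * ∑ v, H i v * y v := by
        rw [Finset.mul_sum]
        exact Finset.sum_congr rfl fun v _ => by
          simp only [Matrix.smul_apply, smul_eq_mul]; ring
      have h2 : |∑ v, H i v * y v| ≤ ∑ v, |y v| := by
        refine (Finset.abs_sum_le_sum_abs _ _).trans (Finset.sum_le_sum fun v _ => ?_)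
        rw [abs_mul, habs _ (hH1 i v), one_mul]
      have h3 := Real.rpow_sum_le_const_mul_sum_rpow Finset.univ y hP
      rw [Finset.card_univ, Fintype.card_fin, ← hMdef] at h3
      have hs : 0 ≤ ∑ v, |y v| := Finset.sum_nonneg fun v _ => abs_nonneg _
      have hs2 : 0 ≤ ∑ v, |y v| ^ P := Finset.sum_nonneg fun v _ => by positivity
      have h4 := Real.rpow_le_rpow (by positivity) h3 (by positivity : 0 ≤ 1 / P)
      rw [← Real.rpow_mul hs, mul_one_div_cancel hP0.ne', Real.rpow_one,
        Real.mul_rpow (by positivity) hs2, ← Real.rpow_mul hM.le] at h4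
      have h5 : M ^ (1 / P - 1) * M ^ ((P - 1) * (1 / P)) = 1 := by
        rw [← Real.rpow_add hM]
        have : 1 / P - 1 + (P - 1) * (1 / P) = 0 := by field_simp; ring
        rw [this, Real.rpow_zero]
      rw [h1, abs_mul, abs_of_nonneg (by positivity)]
      calc _ ≤ M ^ (1 / P - 1) * (M ^ ((P - 1) * (1 / P)) * (∑ v, |y v| ^ P) ^ (1 / P)) :=
            mul_le_mul_of_nonneg_left (h2.trans h4) (by positivity)
        _ = _ := by rw [← mul_assoc, h5, one_mul]
    -- The point is a negative multiple of the signed sum `w` of the rows. By orthogonality `∑ w v ^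
    -- 2 = M ^ 2`, and `c` is the scale at which the power mean bound puts it in the ball.
    · set c : ℝ := M ^ (-(1 / P) - 1 / 2) with hc
      set w : Fin (2 ^ k) → ℝ := fun v => ∑ i, σ i * H i v with hw
      have hw2 : ∑ v, w v ^ 2 = M * M := by
        have h1 : ∀ v, w v ^ 2 = ∑ i, ∑ j, σ i * σ j * (H i v * H j v) := fun v => by
          rw [sq, hw, Finset.sum_mul_sum]
          exact Finset.sum_congr rfl fun i _ => Finset.sum_congr rfl fun j _ => by ring
        simp only [h1]
        rw [Finset.sum_comm]
        have h2 : ∀ i, ∑ v, ∑ j, σ i * σ j * (H i v * H j v) = M := fun i => by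
          rw [Finset.sum_comm]
          simp only [← Finset.mul_sum, hrow, mul_ite, mul_zero, Finset.sum_ite_eq,
            Finset.mem_univ, if_true, hσ, one_mul]
        simp only [h2, Finset.sum_const, Finset.card_univ, Fintype.card_fin, nsmul_eq_mul]
        rw [← hMdef]
      refine ⟨fun v => -(c * w v), ?_, fun i => ?_⟩
      · have h1 : ∀ v, |-(c * w v)| ^ P = c ^ P * |w v| ^ P := fun v => by
          rw [abs_neg, abs_mul, abs_of_nonneg (by positivity),
            Real.mul_rpow (by positivity) (abs_nonneg _)]
        simp only [h1]
        rw [← Finset.mul_sum]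
        have h3 := sum_rpow_le_of_one_le_of_le_two hP h2 w
        rw [hw2, Fintype.card_fin, ← hMdef] at h3
        refine (mul_le_mul_of_nonneg_left h3 (by positivity)).trans (le_of_eq ?_)
        have h4 : M * M = M ^ (2 : ℝ) := by rw [Real.rpow_two]; ring
        rw [h4, hc, ← Real.rpow_mul hM.le, ← Real.rpow_mul hM.le, ← Real.rpow_add hM,
          ← Real.rpow_add hM]
        convert Real.rpow_zero M using 2
        field_simp
        ring
      · have h1 : ∑ v, H i v * w v = σ i * M := by
          simp only [hw, Finset.mul_sum]
          rw [Finset.sum_comm]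
          have h3 : ∀ j, ∑ v, H i v * (σ j * H j v) = σ j * if i = j then M else 0 := fun j => by
            rw [← hrow, Finset.mul_sum]
            exact Finset.sum_congr rfl fun v _ => by ring
          simp [h3]
        have h3 : ∑ v, (M ^ (1 / P - 1) • H) i v * -(c * w v)
            = -(M ^ (1 / P - 1) * c * ∑ v, H i v * w v) := by
          rw [Finset.mul_sum, ← Finset.sum_neg_distrib]
          exact Finset.sum_congr rfl fun v _ => by
            simp only [Matrix.smul_apply, smul_eq_mul]; ring
        have h4 : M ^ (1 / P - 1) * c * M = M ^ (-(1 / (2 : ℝ))) := by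
          rw [hc, ← Real.rpow_add hM]
          nth_rewrite 2 [← Real.rpow_one M]
          rw [← Real.rpow_add hM]
          congr 1
          ring
        rw [h3, h1, max_eq_right h2, ← h4]
        linear_combination (-(M ^ (1 / P - 1) * c * M)) * hσ i

theorem exists_functionals_of_signs (p : ℝ≥0∞) [Fact (1 ≤ p)] (hp : p ≠ ∞) {n k : ℕ}
    (hn : 2 ^ k ≤ n) :
    ∃ a : Fin (2 ^ k) → (PiLp p fun _ : Fin n => ℝ) →ₗ[ℝ] ℝ, (∀ i x, |a i x| ≤ ‖x‖) ∧
      ∀ σ : Fin (2 ^ k) → ℝ, (∀ i, σ i * σ i = 1) → ∃ x ∈ LpBall p n,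
        ∀ i, σ i * a i x = -((2 ^ k : ℕ) : ℝ) ^ (-(1 / max p.toReal 2)) := by
  have hP : 1 ≤ p.toReal := by
    rw [← ENNReal.toReal_one]
    exact ENNReal.toReal_mono hp Fact.out
  have hP0 : 0 < p.toReal := by linarith
  obtain ⟨A, hA, hy⟩ := exists_matrix_of_signs hP k
  set e := Fin.castLEEmb hn with he
  refine ⟨fun i =>
    { toFun := fun x => ∑ v, A i v * x (e v)
      map_add' := fun x y => by simp [mul_add, Finset.sum_add_distrib]
      map_smul' := fun c x => by
        simp only [PiLp.smul_apply, smul_eq_mul, RingHom.id_apply, Finset.mul_sum]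
        exact Finset.sum_congr rfl fun v _ => by ring }, fun i x => ?_, fun σ hσ => ?_⟩
  · refine (hA i fun v => x (e v)).trans ?_
    rw [PiLp.norm_eq_sum hP0]
    refine Real.rpow_le_rpow (Finset.sum_nonneg fun v _ => by positivity) ?_ (by positivity)
    rw [← Finset.sum_map Finset.univ e fun j => |x j| ^ p.toReal]
    exact Finset.sum_le_sum_of_subset_of_nonneg (Finset.subset_univ _)
      fun j _ _ => by positivity
  · obtain ⟨y, hy1, hyσ⟩ := hy σ hσ
    have hext : ∀ v, Function.extend e y 0 (e v) = y v := e.injective.extend_apply y 0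
    refine ⟨WithLp.toLp p (Function.extend e y 0), ?_, fun i => ?_⟩
    · rw [mem_closedBall_zero_iff, PiLp.norm_eq_sum hP0]
      refine Real.rpow_le_one (Finset.sum_nonneg fun v _ => by positivity) ?_ (by positivity)
      rw [← Fintype.sum_of_injective e e.injective (fun v => |y v| ^ p.toReal)]
      · exact hy1
      · intro j hj
        have h0 : Function.extend e y 0 j = 0 := Function.extend_apply' y (0 : Fin n → ℝ) j hj
        simp only [h0, norm_zero]
        exact Real.zero_rpow hP0.ne'
      · intro v
        simp [hext]
    · rw [← hyσ i]
      simp [hext]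

end Functionals

/-! ### The hard instances and their locality -/

section Instances

/-- The sign encoded by a Boolean. -/
def boolSign (b : Bool) : ℝ := if b then 1 else -1

theorem boolSign_mul_self (b : Bool) : boolSign b * boolSign b = 1 := by
  cases b <;> simp [boolSign]

theorem abs_boolSign (b : Bool) : |boolSign b| = 1 := by
  cases b <;> simp [boolSign]

variable {E : Type*} [NormedAddCommGroup E] [NormedSpace ℝ E] {ι : Type*}

/-- The functional `a j` with sign `ϑ.1`, raised to the level `ϑ.2` of `K` levels in `[0, δ]`. -/
def signedPiece (a : ι → E →ₗ[ℝ] ℝ) (δ : ℝ) (K : ℕ) (x : E) (j : ι) (ϑ : Bool × Fin K) : ℝ :=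
  boolSign ϑ.1 * a j x + δ * ((ϑ.2 : ℕ) / K)

/-- The maximum of the signed and shifted functionals. -/
def maxPiece [Fintype ι] [Nonempty ι] (a : ι → E →ₗ[ℝ] ℝ) (δ : ℝ) (K : ℕ) (ϑ : ι → Bool × Fin K) (x : E) : ℝ :=
  Finset.univ.sup' Finset.univ_nonempty fun j => signedPiece a δ K x j (ϑ j)

variable {a : ι → E →ₗ[ℝ] ℝ} {δ : ℝ} {K : ℕ}

/-- For each sign, distinct levels give distinct values because `δ > 0`. -/
theorem card_filter_signedPiece_le (hδ : 0 < δ) (x : E) (j : ι) (y : ℝ)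
    (T : Finset (Bool × Fin K)) : (T.filter (signedPiece a δ K x j · = y)).card ≤ 2 := by
  have h : (T.filter (signedPiece a δ K x j · = y)).card ≤ (Finset.univ : Finset Bool).card := by
    refine Finset.card_le_card_of_injOn Prod.fst (fun _ _ => Finset.mem_coe.2 (Finset.mem_univ _)) ?_
    rintro ⟨b, i⟩ hi ⟨b', i'⟩ hi' rfl
    have h1 := (Finset.mem_filter.1 hi).2
    have h2 := (Finset.mem_filter.1 hi').2
    rw [← h2] at h1
    simp only [signedPiece] at h1
    have hK : (0 : ℝ) < K := by exact_mod_cast i.pos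
    have h3 : δ * ((i : ℕ) / K) = δ * ((i' : ℕ) / K) := by linarith
    have h4 : ((i : ℕ) : ℝ) = (i' : ℕ) := by
      have := mul_left_cancel₀ hδ.ne' h3
      field_simp at this
      exact this
    have h5 : i = i' := Fin.ext (by exact_mod_cast h4)
    rw [h5]
  simpa using h

theorem signedPiece_sub_le (ha : ∀ i x, |a i x| ≤ ‖x‖) (x y : E) (j : ι) (ϑ : Bool × Fin K) :
    signedPiece a δ K x j ϑ ≤ signedPiece a δ K y j ϑ + ‖x - y‖ := by
  have h1 : boolSign ϑ.1 * a j (x - y) ≤ ‖x - y‖ := by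
    refine (le_abs_self _).trans ?_
    rw [abs_mul, abs_boolSign, one_mul]
    exact ha j _
  rw [map_sub] at h1
  simp only [signedPiece]
  linarith

theorem continuous_signedPiece (ha : ∀ i x, |a i x| ≤ ‖x‖) (j : ι) (ϑ : Bool × Fin K) :
    Continuous fun x => signedPiece a δ K x j ϑ := by
  refine (LipschitzWith.of_le_add fun x y => ?_).continuous
  rw [dist_eq_norm]
  exact signedPiece_sub_le ha x y j ϑ

variable [Fintype ι] [Nonempty ι]

theorem signedPiece_le_maxPiece (ϑ : ι → Bool × Fin K) (x : E) (j : ι) :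
    signedPiece a δ K x j (ϑ j) ≤ maxPiece a δ K ϑ x :=
  Finset.le_sup' (fun j => signedPiece a δ K x j (ϑ j)) (Finset.mem_univ j)

theorem lipschitzWith_maxPiece (ha : ∀ i x, |a i x| ≤ ‖x‖) (ϑ : ι → Bool × Fin K) :
    LipschitzWith 1 (maxPiece a δ K ϑ) := by
  refine LipschitzWith.of_le_add fun x y => Finset.sup'_le _ _ fun j _ => ?_
  rw [dist_eq_norm]
  refine (signedPiece_sub_le ha x y j (ϑ j)).trans ?_
  gcongr
  exact signedPiece_le_maxPiece ϑ y j

theorem convexOn_maxPiece (ϑ : ι → Bool × Fin K) {s : Set E} (hs : Convex ℝ s) :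
    ConvexOn ℝ s (maxPiece a δ K ϑ) := by
  refine ⟨hs, fun x _ y _ α β hα hβ hαβ => Finset.sup'_le _ _ fun j _ => ?_⟩
  have h1 := mul_le_mul_of_nonneg_left (signedPiece_le_maxPiece (a := a) (δ := δ) ϑ x j) hα
  have h2 := mul_le_mul_of_nonneg_left (signedPiece_le_maxPiece (a := a) (δ := δ) ϑ y j) hβ
  simp only [smul_eq_mul]
  refine le_trans (le_of_eq ?_) (add_le_add h1 h2)
  simp only [signedPiece, map_add, map_smul, smul_eq_mul]
  linear_combination (-(δ * (((ϑ j).2 : ℕ) / K))) * hαβ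

/-- By continuity the strict inequalities persist near `x`, so there the components in `U` do not
contribute to either maximum. -/
theorem maxPiece_eventuallyEq (ha : ∀ i x, |a i x| ≤ ‖x‖) (x : E) (U : Finset ι)
    (ϑ ϑ' : ι → Bool × Fin K) (heq : ∀ k ∉ U, ϑ k = ϑ' k)
    (h : ∀ j ∈ U, ∃ k ∉ U, signedPiece a δ K x j (ϑ j) < signedPiece a δ K x k (ϑ k))
    (h' : ∀ j ∈ U, ∃ k ∉ U, signedPiece a δ K x j (ϑ' j) < signedPiece a δ K x k (ϑ' k)) :
    maxPiece a δ K ϑ =ᶠ[𝓝 x] maxPiece a δ K ϑ' := by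
  have key : ∀ ϑ ϑ' : ι → Bool × Fin K, (∀ k ∉ U, ϑ k = ϑ' k) →
      (∀ j ∈ U, ∃ k ∉ U, signedPiece a δ K x j (ϑ j) < signedPiece a δ K x k (ϑ k)) →
      ∀ᶠ y in 𝓝 x, maxPiece a δ K ϑ y ≤ maxPiece a δ K ϑ' y := by
    intro ϑ ϑ' heq h
    have h1 : ∀ᶠ y in 𝓝 x, ∀ j ∈ U, ∃ k ∉ U,
        signedPiece a δ K y j (ϑ j) < signedPiece a δ K y k (ϑ k) := by
      rw [Filter.eventually_all_finset]
      intro j hj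
      obtain ⟨k, hk, hlt⟩ := h j hj
      filter_upwards [(continuous_signedPiece ha j (ϑ j)).continuousAt.eventually_lt
        (continuous_signedPiece ha k (ϑ k)).continuousAt hlt] with y hy
      exact ⟨k, hk, hy⟩
    filter_upwards [h1] with y hy
    refine Finset.sup'_le _ _ fun j _ => ?_
    by_cases hj : j ∈ U
    · obtain ⟨k, hk, hlt⟩ := hy j hj
      rw [heq k hk] at hlt
      exact hlt.le.trans (signedPiece_le_maxPiece ϑ' y k)
    · rw [heq j hj]
      exact signedPiece_le_maxPiece ϑ' y j
  filter_upwards [key ϑ ϑ' heq h, key ϑ' ϑ (fun k hk => (heq k hk).symm) h'] with y h1 h2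
  exact le_antisymm h1 h2

theorem maxPiece_mem_lipConvexFamily {p : ℝ≥0∞} [Fact (1 ≤ p)] {n : ℕ}
    {a : ι → (PiLp p fun _ : Fin n => ℝ) →ₗ[ℝ] ℝ} (ha : ∀ i x, |a i x| ≤ ‖x‖)
    (ϑ : ι → Bool × Fin K) :
    (fun x : LpBall p n => maxPiece a δ K ϑ x) ∈ lipConvexFamily p n := by
  refine ⟨?_, maxPiece a δ K ϑ, convexOn_maxPiece ϑ (convex_closedBall _ _), fun _ => rfl⟩
  have h := (lipschitzWith_maxPiece (δ := δ) ha ϑ).comp (LipschitzWith.subtype_val (LpBall p n))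
  rwa [one_mul] at h

/-- An `ε`-minimum of the maximum reveals all the signs. -/
theorem fst_eq_of_isEpsMin {p : ℝ≥0∞} [Fact (1 ≤ p)] {n : ℕ}
    {a : ι → (PiLp p fun _ : Fin n => ℝ) →ₗ[ℝ] ℝ} {ε m : ℝ} (hδ : 0 ≤ δ) (hm : ε + δ ≤ m)
    (hsigns : ∀ σ : ι → ℝ, (∀ i, σ i * σ i = 1) → ∃ x ∈ LpBall p n, ∀ i, σ i * a i x = -m)
    (ϑ : ι → Bool × Fin K) (x : LpBall p n)
    (hx : IsEpsMin (fun x : LpBall p n => maxPiece a δ K ϑ x) ε x) (j : ι) :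
    (ϑ j).1 = decide (a j x < 0) := by
  obtain ⟨z, hz, hxz⟩ := hx
  obtain ⟨w, hw, hwm⟩ := hsigns (fun i => boolSign (ϑ i).1) fun i => boolSign_mul_self _
  -- Hence the value at `x` is less than `-m + δ + ε ≤ 0`. Every piece at `x` is then negative, and,
  -- levels being nonnegative, so is every signed functional.
  have h1 : maxPiece a δ K ϑ w ≤ -m + δ := by
    refine Finset.sup'_le _ _ fun i _ => ?_
    have h2 : (((ϑ i).2 : ℕ) : ℝ) / K ≤ 1 := by
      refine div_le_one_of_le₀ ?_ (Nat.cast_nonneg _)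
      exact_mod_cast (ϑ i).2.isLt.le
    have h3 := mul_le_mul_of_nonneg_left h2 hδ
    have h4 := hwm i
    simp only [signedPiece, h4]
    linarith
  have h2 := hz ⟨w, hw⟩
  have h3 := signedPiece_le_maxPiece (a := a) (δ := δ) ϑ (x : PiLp p fun _ : Fin n => ℝ) j
  have h4 : 0 ≤ δ * (((ϑ j).2 : ℕ) / K) := by positivity
  have h5 : boolSign (ϑ j).1 * a j x < 0 := by
    simp only [signedPiece] at h3
    simp only at h2 hxz
    linarith
  cases hb : (ϑ j).1 <;> simp only [hb, boolSign, if_true, Bool.false_eq_true, if_false] at h5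
  · symm
    rw [decide_eq_false_iff_not]
    linarith
  · symm
    rw [decide_eq_true_iff]
    linarith

end Instances

/-! ### Uniform laws on finitely many instances -/

section Averages

/-- A continuous function is determined by its values on a countable dense set. Measurable
singletons allow integration against Dirac measures of integrands not known to be measurable. -/
instance instMeasurableSingletonClassLipConvexFamily (p : ℝ≥0∞) [Fact (1 ≤ p)] (n : ℕ) :
    MeasurableSingletonClass (lipConvexFamily p n) where
  measurableSet_singleton f := by
    obtain ⟨D, hDc, hD⟩ := TopologicalSpace.exists_countable_dense (LpBall p n)
    have h : ({f} : Set (lipConvexFamily p n)) = ⋂ q ∈ D, {g | g.1 q = f.1 q} := by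
      ext g
      simp only [Set.mem_singleton_iff, Set.mem_iInter, Set.mem_ofPred_eq]
      refine ⟨fun h q _ => by rw [h], fun h => Subtype.ext ?_⟩
      exact Continuous.ext_on hD g.2.1.continuous f.2.1.continuous h
    rw [h]
    refine MeasurableSet.biInter hDc fun q _ => ?_
    exact ((measurable_pi_apply q).comp measurable_subtype_coe) (measurableSet_singleton _)

variable {Ω T : Type*} [MeasurableSpace Ω] [MeasurableSingletonClass Ω] [Fintype T] [Nonempty T]

/-- The distribution of `F` at a uniformly random point of a finite type. -/
def uniformLaw (F : T → Ω) : ProbabilityMeasure Ω :=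
  ⟨(Fintype.card T : ℝ≥0∞)⁻¹ • ∑ ϑ, Measure.dirac (F ϑ), ⟨by
    simp [ENNReal.inv_mul_cancel]⟩⟩

theorem lintegral_uniformLaw (F : T → Ω) (g : Ω → ℝ≥0∞) :
    ∫⁻ f, g f ∂(uniformLaw F : Measure Ω) = (Fintype.card T : ℝ≥0∞)⁻¹ * ∑ ϑ, g (F ϑ) := by
  simp [uniformLaw, lintegral_smul_measure, lintegral_finsetSum_measure, lintegral_dirac]

open Classical in
theorem uniformLaw_apply (F : T → Ω) (s : Set Ω) :
    (uniformLaw F : Measure Ω) s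
      = (Fintype.card T : ℝ≥0∞)⁻¹ * (Finset.univ.filter fun ϑ => F ϑ ∈ s).card := by
  simp [uniformLaw, Measure.dirac_apply, Set.indicator_apply]

theorem inv_card_mul_sum_const (c : ℝ≥0∞) :
    (Fintype.card T : ℝ≥0∞)⁻¹ * ∑ _ϑ : T, c = c := by
  rw [Finset.sum_const, Finset.card_univ, nsmul_eq_mul, ← mul_assoc,
    ENNReal.inv_mul_cancel (by simp) (by simp), one_mul]

end Averages

/-! ### From counting bounds to complexity bounds -/

section Reduction

theorem OracleAlg.findTime_le_queryCount_of_succeeds {X R : Type*} (A : OracleAlg X R) {a : X → R} {f : X → ℝ}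
{ε : ℝ}
    (h : A.Succeeds a f ε) : A.findTime a f ε ≤ A.queryCount a := by
  obtain ⟨t, _, hmin, hgood⟩ := h
  refine (iInf₂_le t hgood).trans (le_iInf₂ fun s hs => ?_)
  exact_mod_cast not_lt.1 fun hlt => hmin s hlt hs

variable {X : Type*} [TopologicalSpace X] {𝓕 : Set (X → ℝ)} {R : Type*}
  [MeasurableSingletonClass 𝓕] {T : Type*} [Fintype T] [Nonempty T]
  {O : LocalOracle 𝓕 R} {ε : ℝ} {F : T → 𝓕} {τ d : ℝ≥0∞}

open Classical in
-- Markov's inequality in additive form: adding `τ` on the early instances makes every summand at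
-- least `τ`.
theorem sub_mul_le_lintegral_findTime (A : OracleAlg X R) (hτ : τ ≠ ∞)
    (h : ((Finset.univ.filter fun ϑ => A.findTime (O.answer (F ϑ)) (F ϑ).1 ε < τ).card : ℝ≥0∞)
      ≤ d * Fintype.card T) :
    τ * (1 - d) ≤ ∫⁻ f, A.findTime (O.answer f) f.1 ε ∂(uniformLaw F : Measure 𝓕) := by
  rw [lintegral_uniformLaw, ENNReal.mul_sub fun _ _ => hτ, mul_one, tsub_le_iff_right]
  calc τ = (Fintype.card T : ℝ≥0∞)⁻¹ * ∑ _ϑ : T, τ := (inv_card_mul_sum_const τ).symm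
    _ ≤ (Fintype.card T : ℝ≥0∞)⁻¹ * ∑ ϑ, (A.findTime (O.answer (F ϑ)) (F ϑ).1 ε +
          if A.findTime (O.answer (F ϑ)) (F ϑ).1 ε < τ then τ else 0) := by
        gcongr with ϑ
        split_ifs with hlt
        · exact le_add_self
        · simpa using hlt
    _ = (Fintype.card T : ℝ≥0∞)⁻¹ * ∑ ϑ, A.findTime (O.answer (F ϑ)) (F ϑ).1 ε +
        (Fintype.card T : ℝ≥0∞)⁻¹ * (((Finset.univ.filter fun ϑ =>
          A.findTime (O.answer (F ϑ)) (F ϑ).1 ε < τ).card : ℝ≥0∞) * τ) := by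
        rw [Finset.sum_add_distrib, mul_add, ← Finset.sum_filter, Finset.sum_const, nsmul_eq_mul]
    _ ≤ _ := by
        refine add_le_add le_rfl ?_
        calc _ ≤ (Fintype.card T : ℝ≥0∞)⁻¹ * (d * Fintype.card T * τ) := by gcongr
          _ = (Fintype.card T : ℝ≥0∞)⁻¹ * Fintype.card T * (τ * d) := by ring
          _ = τ * d := by rw [ENNReal.inv_mul_cancel (by simp) (by simp), one_mul]

open Classical in
theorem uniformLaw_findTime_lt_le (A : OracleAlg X R)
    (h : ((Finset.univ.filter fun ϑ => A.findTime (O.answer (F ϑ)) (F ϑ).1 ε < τ).card : ℝ≥0∞)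
      ≤ d * Fintype.card T) :
    (uniformLaw F : Measure 𝓕) {f | A.findTime (O.answer f) f.1 ε < τ} ≤ d := by
  rw [uniformLaw_apply]
  calc _ ≤ (Fintype.card T : ℝ≥0∞)⁻¹ * (d * Fintype.card T) := by
        gcongr
        simpa only [Set.mem_ofPred_eq] using h
    _ = (Fintype.card T : ℝ≥0∞)⁻¹ * Fintype.card T * d := by ring
    _ = d := by rw [ENNReal.inv_mul_cancel (by simp) (by simp), one_mul]

open Classical in
-- Every run fails, asks at least `τ` queries, or succeeds early. For each fixed seed the last event
-- forces an early find by a deterministic algorithm, so exchanging the sum over instances with the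
-- integral over seeds bounds its probability by `d`.
theorem RandOracleAlg.sub_le_probQueriesGe (B : RandOracleAlg O ε)
    (h : ∀ A : OracleAlg X R, ((Finset.univ.filter fun ϑ =>
      A.findTime (O.answer (F ϑ)) (F ϑ).1 ε < τ).card : ℝ≥0∞) ≤ d * Fintype.card T) :
    1 - B.errorProb (uniformLaw F) - d ≤ B.probQueriesGe (uniformLaw F) τ := by
  rw [RandOracleAlg.errorProb, RandOracleAlg.probQueriesGe, lintegral_uniformLaw,
    lintegral_uniformLaw, tsub_le_iff_right, tsub_le_iff_right]
  let G : T → Set B.Seed := fun ϑ =>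
    {ω | (B.alg ω).Succeeds (O.answer (F ϑ)) (F ϑ).1 ε} ∩
      {ω | (B.alg ω).queryCount (O.answer (F ϑ)) < τ}
  have hG : ∀ ϑ, MeasurableSet (G ϑ) := fun ϑ =>
    (B.measurableSet_succeeds (F ϑ)).inter
      (measurableSet_lt (B.measurable_queryCount (F ϑ)) measurable_const)
  have hGd : (Fintype.card T : ℝ≥0∞)⁻¹ * ∑ ϑ, B.law (G ϑ) ≤ d := by
    have h1 : ∑ ϑ, B.law (G ϑ) ≤ d * Fintype.card T := by
      calc ∑ ϑ, B.law (G ϑ) = ∑ ϑ, ∫⁻ ω, (G ϑ).indicator 1 ω ∂B.law :=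
            Finset.sum_congr rfl fun ϑ _ => (lintegral_indicator_one (hG ϑ)).symm
        _ = ∫⁻ ω, ∑ ϑ, (G ϑ).indicator 1 ω ∂B.law :=
            (lintegral_finsetSum _ fun ϑ _ => measurable_one.indicator (hG ϑ)).symm
        _ ≤ ∫⁻ _, d * Fintype.card T ∂B.law := by
            refine lintegral_mono fun ω => le_trans ?_ (h (B.alg ω))
            simp only [Set.indicator_apply, Pi.one_apply]
            rw [Finset.sum_boole]
            refine Nat.cast_le.2 (Finset.card_le_card fun ϑ hϑ => ?_)
            obtain ⟨hs, hq⟩ := (Finset.mem_filter.1 hϑ).2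
            exact Finset.mem_filter.2 ⟨Finset.mem_univ _,
              ((B.alg ω).findTime_le_queryCount_of_succeeds hs).trans_lt hq⟩
        _ = d * Fintype.card T := by simp
    calc _ ≤ (Fintype.card T : ℝ≥0∞)⁻¹ * (d * Fintype.card T) := by gcongr
      _ = (Fintype.card T : ℝ≥0∞)⁻¹ * Fintype.card T * d := by ring
      _ = d := by rw [ENNReal.inv_mul_cancel (by simp) (by simp), one_mul]
  calc (1 : ℝ≥0∞) = (Fintype.card T : ℝ≥0∞)⁻¹ * ∑ _ϑ : T, 1 := (inv_card_mul_sum_const 1).symm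
    _ ≤ (Fintype.card T : ℝ≥0∞)⁻¹ * ∑ ϑ,
          (B.law {ω | τ ≤ (B.alg ω).queryCount (O.answer (F ϑ))} + B.law (G ϑ) +
            B.law {ω | ¬ (B.alg ω).Succeeds (O.answer (F ϑ)) (F ϑ).1 ε}) := by
        gcongr with ϑ
        rw [← measure_univ (μ := B.law)]
        refine le_trans (measure_mono fun ω _ => ?_)
          ((measure_union_le _ _).trans (add_le_add (measure_union_le _ _) le_rfl))
        simp only [G, Set.mem_union, Set.mem_inter_iff, Set.mem_ofPred_eq]
        by_cases h1 : (B.alg ω).Succeeds (O.answer (F ϑ)) (F ϑ).1 ε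
        · rcases le_or_gt τ ((B.alg ω).queryCount (O.answer (F ϑ))) with h2 | h2 <;> tauto
        · tauto
    _ ≤ _ := by
        rw [Finset.sum_add_distrib, Finset.sum_add_distrib, mul_add, mul_add]
        gcongr

theorem RandOracleAlg.mul_probQueriesGe_le_expectedQueries (B : RandOracleAlg O ε) (F : T → 𝓕)
    (τ : ℝ≥0∞) :
    τ * B.probQueriesGe (uniformLaw F) τ ≤ B.expectedQueries (uniformLaw F) := by
  rw [RandOracleAlg.probQueriesGe, RandOracleAlg.expectedQueries, lintegral_uniformLaw,
    lintegral_uniformLaw, mul_left_comm, Finset.mul_sum]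
  gcongr with ϑ
  exact mul_meas_ge_le_lintegral (B.measurable_queryCount (F ϑ)) τ

end Reduction

/-! ### Hard distributions for a given oracle -/

section HardInstances

variable {p : ℝ≥0∞} [Fact (1 ≤ p)] {n : ℕ} {R : Type*}

open Classical in
/-- A random instance with `M = 2 ^ k` components is solved with fewer than `M / 12` queries only
with exponentially small probability. -/
theorem exists_instances_card_findTime_lt_le (hp : p ≠ ∞) {k : ℕ} (hn : 2 ^ k ≤ n) {ε : ℝ}
    (hε : ε < ((2 ^ k : ℕ) : ℝ) ^ (-(1 / max p.toReal 2)))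
    (O : LocalOracle (lipConvexFamily p n) R) :
    ∃ (T : Type) (_ : Fintype T) (_ : Nonempty T) (F : T → lipConvexFamily p n),
      ∀ τ : ℝ, 12 * τ ≤ (2 ^ k : ℕ) → ∀ A : OracleAlg (LpBall p n) R,
        ((Finset.univ.filter fun ϑ =>
          A.findTime (O.answer (F ϑ)) (F ϑ).1 ε < ENNReal.ofReal τ).card : ℝ≥0∞)
        ≤ ENNReal.ofReal (2 * 2 ^ (-((2 ^ k : ℕ) : ℝ) / 4)) * Fintype.card T := by
  set m : ℝ := ((2 ^ k : ℕ) : ℝ) ^ (-(1 / max p.toReal 2)) with hm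
  obtain ⟨a, ha, hsigns⟩ := exists_functionals_of_signs p hp hn
  have hδ : 0 < m - ε := sub_pos.2 hε
  have : Nonempty (Fin (2 ^ k)) := ⟨⟨0, by positivity⟩⟩
  obtain ⟨K, hK, hcount⟩ := exists_levels_card_success_le (Fin (2 ^ k))
  have : NeZero K := ⟨hK.ne'⟩
  let F : (Fin (2 ^ k) → Bool × Fin K) → lipConvexFamily p n := fun ϑ =>
    ⟨fun x => maxPiece a (m - ε) K ϑ x, maxPiece_mem_lipConvexFamily ha ϑ⟩
  refine ⟨_, inferInstance, inferInstance, F, fun τ hτ A => ?_⟩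
  have h1 := hcount (LpBall p n) R A (fun x => signedPiece a (m - ε) K x)
    (fun x j y S => card_filter_signedPiece_le hδ _ _ _ _) (fun ϑ => O.answer (F ϑ))
    (fun x U ϑ ϑ' heq h h' => O.isLocal _ _ _ <|
      continuous_subtype_val.continuousAt.eventually (maxPiece_eventuallyEq ha x U ϑ ϑ' heq h h'))
    (fun ϑ x => IsEpsMin (F ϑ).1 ε x) (fun x j => decide (a j x < 0))
    (fun ϑ x hx j => fst_eq_of_isEpsMin hδ.le (by linarith) hsigns ϑ x hx j)
    -- Rounding down is harmless: an integer `t < τ` satisfies `12 * t ≤ 2 ^ k`.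
    (2 ^ k / 12) (by rw [Fintype.card_fin]; omega)
  rw [Fintype.card_fin] at h1
  have h2 : (Finset.univ.filter fun ϑ =>
        A.findTime (O.answer (F ϑ)) (F ϑ).1 ε < ENNReal.ofReal τ) ⊆
      Finset.univ.filter fun ϑ => A.FindsWithin (O.answer (F ϑ))
        (fun x => IsEpsMin (F ϑ).1 ε x) 0 (2 ^ k / 12) := by
    intro ϑ hϑ
    have h3 := (Finset.mem_filter.1 hϑ).2
    simp only [OracleAlg.findTime, iInf_lt_iff] at h3
    obtain ⟨t, hgood, ht⟩ := h3
    refine Finset.mem_filter.2 ⟨Finset.mem_univ _, t, ?_, by rwa [zero_add]⟩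
    have h4 : (t : ℝ) < τ := by
      rw [← ENNReal.ofReal_natCast] at ht
      exact (ENNReal.ofReal_lt_ofReal_iff_of_nonneg (Nat.cast_nonneg t)).1 ht
    have h5 : t * 12 ≤ 2 ^ k := by
      have : (t * 12 : ℝ) ≤ (2 ^ k : ℕ) := by linarith
      exact_mod_cast this
    exact (Nat.le_div_iff_mul_le (by norm_num)).2 h5
  have h6 : (((Finset.univ.filter fun ϑ =>
        A.findTime (O.answer (F ϑ)) (F ϑ).1 ε < ENNReal.ofReal τ).card : ℕ) : ℝ)
      ≤ 2 * 2 ^ (-((2 ^ k : ℕ) : ℝ) / 4) * Fintype.card (Fin (2 ^ k) → Bool × Fin K) :=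
    (Nat.cast_le.2 (Finset.card_le_card h2)).trans h1
  rw [← ENNReal.ofReal_natCast, ← ENNReal.ofReal_natCast (Fintype.card _),
    ← ENNReal.ofReal_mul (by positivity)]
  exact ENNReal.ofReal_le_ofReal h6

open Classical in
/-- Without a query, at most one of a pair of linear instances is solved. -/
theorem exists_pair_card_findTime_lt_le (hp : p ≠ ∞) (hn : 1 ≤ n) {ε : ℝ} (hε : ε ≤ 1)
    (O : LocalOracle (lipConvexFamily p n) R) :
    ∃ F : Bool → lipConvexFamily p n, ∀ A : OracleAlg (LpBall p n) R,
      ((Finset.univ.filter fun ϑ => A.findTime (O.answer (F ϑ)) (F ϑ).1 ε < 1).card : ℝ≥0∞)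
        ≤ 2⁻¹ * Fintype.card Bool := by
  obtain ⟨a, ha, hsigns⟩ := exists_functionals_of_signs p hp (k := 0) (n := n) (by simpa using hn)
  have : Nonempty (Fin (2 ^ 0)) := ⟨⟨0, by positivity⟩⟩
  let i₀ : Fin (2 ^ 0) := ⟨0, by positivity⟩
  -- One functional and a single level of height zero: the minimum is at most `-1`, so even `ε = 1`
  -- forces the sign.
  let F : Bool → lipConvexFamily p n := fun b =>
    ⟨fun x => maxPiece a 0 1 (fun _ => (b, 0)) x, maxPiece_mem_lipConvexFamily ha _⟩
  refine ⟨F, fun A => ?_⟩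
  have h1 : (Finset.univ.filter fun b => A.findTime (O.answer (F b)) (F b).1 ε < 1)
      ⊆ {decide (a i₀ (A.output []) < 0)} := by
    intro b hb
    have h3 := (Finset.mem_filter.1 hb).2
    simp only [OracleAlg.findTime, iInf_lt_iff] at h3
    obtain ⟨t, hgood, ht⟩ := h3
    have ht0 : t = 0 := by
      have : t < 1 := by exact_mod_cast ht
      omega
    subst ht0
    exact Finset.mem_singleton.2 (fst_eq_of_isEpsMin le_rfl (by simpa using hε) hsigns
      (fun _ => (b, 0)) (A.output []) hgood i₀)
  have h2 := Finset.card_le_card h1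
  rw [Finset.card_singleton] at h2
  calc _ ≤ ((1 : ℕ) : ℝ≥0∞) := Nat.cast_le.2 h2
    _ = _ := by simp [ENNReal.inv_mul_cancel]

end HardInstances

/-! ### The error term and an exponential estimate -/

section Asymptotics

theorem tendsto_four_mul_two_rpow :
    Tendsto (fun ε : ℝ => 4 * (2 : ℝ) ^ (-(ε⁻¹ ^ 2) / 16)) (𝓝[>] 0) (𝓝 0) := by
  have h1 : Tendsto (fun ε : ℝ => ε⁻¹ ^ 2) (𝓝[>] 0) atTop :=
    (tendsto_pow_atTop two_ne_zero).comp tendsto_inv_nhdsGT_zero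
  have h2 : Tendsto (fun x : ℝ => (2 : ℝ) ^ (-x / 16)) atTop (𝓝 0) := by
    have h3 : Tendsto (fun x : ℝ => -x / 16) atTop atBot :=
      (tendsto_neg_atTop_atBot).atBot_div_const (by norm_num)
    exact (tendsto_rpow_atBot_of_base_gt_one 2 (by norm_num)).comp h3
  simpa using (h2.comp h1).const_mul 4

theorem half_le_two_rpow (x : ℝ) (hx : 0 ≤ x) : x / 2 ≤ 2 ^ x := by
  rw [Real.rpow_def_of_pos (by norm_num)]
  have h1 := Real.add_one_le_exp (Real.log 2 * x)
  nlinarith [Real.log_two_gt_d9]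

end Asymptotics

end

theorem theorem6p2 :
    ∃ c C : ℝ, 0 < c ∧ 0 < C ∧ ∃ η : ℝ → ℝ, Tendsto η (𝓝[>] 0) (𝓝 0) ∧
      ∀ (p : ℝ≥0∞) [Fact (1 ≤ p)] (_ : p ≠ ∞) (n : ℕ) (_ : 1 ≤ n) (ε : ℝ)
        (_ : 1 / (n : ℝ) ^ (1 / max p.toReal 2) ≤ ε) (_ : ε ≤ 1)
        (R : Type*) (O : LocalOracle (lipConvexFamily p n) R),
        ENNReal.ofReal (c / ε ^ max p.toReal 2) ≤ distComplexity O ε ∧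
        ENNReal.ofReal (c / ε ^ max p.toReal 2) ≤ hpComplexity O ε (η ε) ∧
        ∀ Pe : ℝ, 0 ≤ Pe → Pe < 1 →
          (C ≤ (1 - Pe) / ε ^ max p.toReal 2 →
            ENNReal.ofReal (c * (1 - Pe) / ε ^ max p.toReal 2) ≤ distComplexityErr O ε Pe) ∧
          ENNReal.ofReal (c / ε ^ max p.toReal 2) ≤ hpComplexityErr O ε Pe (η ε) := by
  -- Below, `τ = E / 48` with `E = ε^(-r)`, and at least half of the relevant probability survives,
  -- whence `1 / 96`. The error term is stated with `ε^(-2) ≤ E`, so that it does not depend on `p`.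
  refine ⟨1 / 96, 128, by norm_num, by norm_num, _, tendsto_four_mul_two_rpow, ?_⟩
  intro p _ hp n hn ε hnε hε1 R O
  set r := max p.toReal 2 with hr
  have hr2 : 2 ≤ r := le_max_right _ _
  have hr0 : 0 < r := by linarith
  have hn0 : (0 : ℝ) < n := by exact_mod_cast hn
  have hε0 : 0 < ε := lt_of_lt_of_le (by positivity) hnε
  have hεr : 0 < ε ^ r := by positivity
  set E := (ε ^ r)⁻¹ with hE
  have hE0 : 0 < E := inv_pos.2 hεr
  have hEn : E ≤ n := by
    rw [hE, inv_le_comm₀ hεr hn0]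
    have h1 := Real.rpow_le_rpow (by positivity) hnε hr0.le
    rwa [one_div, Real.inv_rpow (by positivity), ← Real.rpow_mul hn0.le,
      one_div_mul_cancel hr0.ne', Real.rpow_one] at h1
  have hεE : ε⁻¹ ^ 2 ≤ E := by
    rw [hE, inv_pow]
    refine inv_anti₀ hεr ?_
    rw [← Real.rpow_two]
    exact Real.rpow_le_rpow_of_exponent_ge hε0 hε1 hr2
  have hdiv : ∀ b : ℝ, b / ε ^ r = b * E := fun b => by rw [hE, div_eq_mul_inv]
  simp only [hdiv]
  rcases le_or_gt E 32 with hE32 | hE32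
  · -- the bounds are below one query
    obtain ⟨F, hF⟩ := exists_pair_card_findTime_lt_le hp hn hε1 O
    -- The factor `4` in the error term makes both high-probability bounds trivial for `E ≤ 32`.
    have hη : 1 ≤ 4 * (2 : ℝ) ^ (-(ε⁻¹ ^ 2) / 16) := by
      have h1 : (2 : ℝ) ^ (-2 : ℝ) ≤ 2 ^ (-(ε⁻¹ ^ 2) / 16) :=
        Real.rpow_le_rpow_of_exponent_le (by norm_num) (by linarith)
      have h2 : (2 : ℝ) ^ (-2 : ℝ) = 1 / 4 := by
        rw [Real.rpow_neg (by norm_num), Real.rpow_two]; norm_num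
      linarith
    refine ⟨?_, ?_, fun Pe hPe0 hPe1 => ⟨fun hC => ?_, ?_⟩⟩
    · refine le_trans ?_ (le_iSup _ (uniformLaw F))
      refine le_iInf fun A => le_trans ?_
        (sub_mul_le_lintegral_findTime (τ := 1) (d := 2⁻¹) A ENNReal.one_ne_top (hF A))
      rw [one_mul, ENNReal.one_sub_inv_two, ← ENNReal.ofReal_ofNat, ← ENNReal.ofReal_inv_of_pos
        (by norm_num)]
      exact ENNReal.ofReal_le_ofReal (by linarith)
    · refine le_trans ?_ (le_iSup _ (uniformLaw F))
      refine le_iInf fun A => le_sSup (le_trans prob_le_one ?_)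
      rwa [ENNReal.one_le_ofReal]
    -- Vacuous: `(1 - Pe) * E ≤ 32 < 128`.
    · nlinarith
    · refine le_trans ?_ (le_iSup _ (uniformLaw F))
      refine le_iInf₂ fun B _ => le_sSup ?_
      rw [Set.mem_ofPred_eq, ENNReal.ofReal_of_nonpos (by linarith)]
      exact zero_le
  -- Taking `M ≤ E / 2` rather than `M ≤ E` makes `ε < M^(-1/r)` strict and leaves room for levels
  -- of positive height; maximality of `k` gives `M > E / 4`.
  obtain ⟨k, hk1, hk2⟩ := exists_nat_pow_near (x := E / 2) (y := 2) (by linarith) (by norm_num)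
  set M : ℝ := ((2 ^ k : ℕ) : ℝ) with hM
  have hM2 : M = 2 ^ k := by rw [hM]; push_cast; rfl
  rw [← hM2] at hk1
  rw [pow_succ, ← hM2] at hk2
  have hM0 : 0 < M := by rw [hM2]; positivity
  have hεM : ε < M ^ (-(1 / r)) := by
    have h1 : ε = E ^ (-(1 / r)) := by
      rw [hE, Real.inv_rpow hεr.le, ← Real.rpow_mul hε0.le, ← Real.rpow_neg hε0.le]
      field_simp
      simp
    rw [h1]
    exact Real.rpow_lt_rpow_of_neg hM0 (by linarith) (by simpa using hr0)
  have hkn : 2 ^ k ≤ n := by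
    have : M ≤ n := by linarith
    rw [hM] at this
    exact_mod_cast this
  obtain ⟨T, _, _, F, hF⟩ := exists_instances_card_findTime_lt_le hp hkn hεM O
  rw [← hM] at hF
  set d : ℝ := 2 * 2 ^ (-M / 4) with hd
  have hd0 : 0 ≤ d := by positivity
  have hdE : d ≤ 2 * 2 ^ (-E / 16) := by
    have : (2 : ℝ) ^ (-M / 4) ≤ 2 ^ (-E / 16) :=
      Real.rpow_le_rpow_of_exponent_le (by norm_num) (by linarith)
    linarith
  have hdη : d ≤ 4 * (2 : ℝ) ^ (-(ε⁻¹ ^ 2) / 16) := by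
    have h1 : (2 : ℝ) ^ (-E / 16) ≤ 2 ^ (-(ε⁻¹ ^ 2) / 16) :=
      Real.rpow_le_rpow_of_exponent_le (by norm_num) (by linarith)
    have h2 : (0 : ℝ) ≤ 2 ^ (-(ε⁻¹ ^ 2) / 16) := by positivity
    linarith
  set τ : ℝ := E / 48 with hτ
  have hτ0 : 0 ≤ τ := by positivity
  replace hF := hF τ (by linarith)
  have hsub : ∀ (Pe : ℝ) (B : RandOracleAlg O ε), B.errorProb (uniformLaw F) ≤ ENNReal.ofReal Pe →
      0 ≤ Pe → ENNReal.ofReal (1 - Pe - d) ≤ B.probQueriesGe (uniformLaw F) (ENNReal.ofReal τ) := by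
    intro Pe B hB hPe
    refine le_trans ?_ (B.sub_le_probQueriesGe hF)
    rw [ENNReal.ofReal_sub _ hd0, ENNReal.ofReal_sub _ hPe, ENNReal.ofReal_one]
    gcongr
  refine ⟨?_, ?_, fun Pe hPe0 hPe1 => ⟨fun hC => ?_, ?_⟩⟩
  · refine le_trans ?_ (le_iSup _ (uniformLaw F))
    refine le_iInf fun A => le_trans ?_
      (sub_mul_le_lintegral_findTime A ENNReal.ofReal_ne_top (hF A))
    rw [← ENNReal.ofReal_one, ← ENNReal.ofReal_sub _ hd0, ← ENNReal.ofReal_mul hτ0]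
    refine ENNReal.ofReal_le_ofReal ?_
    have h1 : (2 : ℝ) ^ (-E / 16) ≤ 2 ^ (-2 : ℝ) :=
      Real.rpow_le_rpow_of_exponent_le (by norm_num) (by linarith)
    have h2 : (2 : ℝ) ^ (-2 : ℝ) = 1 / 4 := by
      rw [Real.rpow_neg (by norm_num), Real.rpow_two]; norm_num
    nlinarith
  · refine le_trans ?_ (le_iSup _ (uniformLaw F))
    refine le_iInf fun A => le_trans (b := ENNReal.ofReal τ)
      (ENNReal.ofReal_le_ofReal (by linarith)) (le_sSup ?_)
    exact (uniformLaw_findTime_lt_le A (hF A)).trans (ENNReal.ofReal_le_ofReal hdη)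
  · refine le_trans ?_ (le_iSup _ (uniformLaw F))
    refine le_iInf₂ fun B hB => le_trans ?_ (B.mul_probQueriesGe_le_expectedQueries F
      (ENNReal.ofReal τ))
    refine le_trans ?_ (mul_le_mul_right (hsub Pe B hB hPe0) _)
    rw [← ENNReal.ofReal_mul hτ0]
    refine ENNReal.ofReal_le_ofReal ?_
    -- From `2^(E/16) ≥ E / 32` follows `d ≤ 64 / E`, and `(1 - Pe) * E ≥ 128` is exactly what is
    -- needed.
    have h1 : d ≤ (1 - Pe) / 2 := by
      have h2 := half_le_two_rpow (E / 16) (by positivity)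
      have h3 : (2 : ℝ) ^ (-E / 16) * 2 ^ (E / 16) = 1 := by
        rw [← Real.rpow_add (by norm_num), neg_div, neg_add_cancel, Real.rpow_zero]
      have h4 : (0 : ℝ) ≤ 2 ^ (-E / 16) := by positivity
      have h5 := mul_le_mul_of_nonneg_left h2 h4
      rw [h3] at h5
      have h6 : 2 ^ (-E / 16) * E ≤ (1 - Pe) / 4 * E := by linarith
      have h7 := le_of_mul_le_mul_right h6 hE0
      linarith
    have h2 : τ * ((1 - Pe) / 2) ≤ τ * (1 - Pe - d) :=
      mul_le_mul_of_nonneg_left (by linarith) hτ0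
    refine le_trans (le_of_eq ?_) h2
    rw [hτ]; ring
  · refine le_trans ?_ (le_iSup _ (uniformLaw F))
    refine le_iInf₂ fun B hB => le_trans (b := ENNReal.ofReal τ)
      (ENNReal.ofReal_le_ofReal (by linarith)) (le_sSup ?_)
    exact (ENNReal.ofReal_le_ofReal (by linarith)).trans (hsub Pe B hB hPe0)
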